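/- Let $\mathbb D$ and $\mathbb T$ be the open unit disc and the unit circle in $\mathbb C$, let $\overline{\mathbb D}$ be the closed unit disc, let $dA$ be the normalized area measure on $\mathbb D$, and let $M_+(\overline{\mathbb D})$ be the set of finite positive Borel measures on $\overline{\mathbb D}$. For $\mu\in M_+(\overline{\mathbb D})$ put $$U_\mu(w)=\int_{\mathbb D}\log\left|\frac{1-\overline\zeta w}{w-\zeta}\right|^2\frac{d\mu(\zeta)}{1-|\zeta|^2}+\int_{\mathbb T}\frac{1-|w|^2}{|\zeta-w|^2}\,d\mu(\zeta),\qquad w\in\mathbb D.$$ For $\mu_1,\mu_2\in M_+(\overline{\mathbb D})$ and a holomorphic function $f$ on $\mathbb D^2$ put $$\mathcal D_{\mu_1,\mu_2}(f)=\sup_{0<r<1}\int_0^{2\pi}\!\int_{\mathbb D}|\partial_1f(z_1,re^{i\theta})|^2U_{\mu_1}(z_1)\,dA(z_1)\frac{d\theta}{2\pi}+\sup_{0<r<1}\int_0^{2\pi}\!\int_{\mathbb D}|\partial_2f(re^{i\theta},z_2)|^2U_{\mu_2}(z_2)\,dA(z_2)\frac{d\theta}{2\pi},$$ and let $\mathcal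 D(\mu_1,\mu_2)=\{f\in H^2(\mathbb D^2):\mathcal D_{\mu_1,\mu_2}(f)<\infty\}$ with the norm $\|f\|^2=\|f\|^2_{H^2(\mathbb D^2)}+\mathcal D_{\mu_1,\mu_2}(f)$, where $H^2(\mathbb D^2)$ is the Hardy space of the bidisc with its norm $$\|f\|^2_{H^2(\mathbb D^2)}=\sup_{0<r<1}\int_0^{2\pi}\!\int_0^{2\pi}|f(re^{i\alpha},re^{i\beta})|^2\frac{d\beta}{2\pi}\frac{d\alpha}{2\pi}.$$ Let $\mathscr M_z=(\mathscr M_{z_1},\mathscr M_{z_2})$ be the pair of multiplication operators $f\mapsto z_1f$, $f\mapsto z_2f$ on $\mathcal D(\mu_1,\mu_2)$. **Theorem.** Let $\mu_1^{(i)},\mu_2^{(i)}\in M_+(\overline{\mathbb D})$ for $i=1,2$. The pair $\mathscr M_z^{(1)}$ on $\mathcal D(\mu_1^{(1)},\mu_2^{(1)})$ is unitarily equivalent to the pair $\mathscr M_z^{(2)}$ on $\mathcal D(\mu_1^{(2)},\mu_2^{(2)})$ if and only if $\mu_j^{(1)}=\mu_j^{(2)}$ for $j=1,2$. Here unitary equivalence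 means that there is a surjective linear isometry $U:\mathcal D(\mu_1^{(1)},\mu_2^{(1)})\to\mathcal D(\mu_1^{(2)},\mu_2^{(2)})$ such that for $j=1,2$ and every $f\in\mathcal D(\mu_1^{(1)},\mu_2^{(1)})$ the function $z_jf$ belongs to $\mathcal D(\mu_1^{(1)},\mu_2^{(1)})$ and $U(z_jf)=z_j\,Uf$. -/

import Mathlib

open MeasureTheory Set Filter Topology
open scoped ENNReal ComplexConjugate

namespace DirichletBidisc

/-- The open unit disc in the complex plane. -/
def disc : Set ℂ := Metric.ball 0 1

/-- The closed unit disc in the complex plane, as a type. -/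
abbrev ClosedDisc : Type := Metric.closedBall (0 : ℂ) 1

/-- The open unit bidisc. -/
def bidisc : Set (ℂ × ℂ) := disc ×ˢ disc

/-- Normalized Lebesgue area measure `dA` on the open unit disc. -/
noncomputable def area : Measure ℂ :=
  (ENNReal.ofReal Real.pi)⁻¹ • volume.restrict disc

/-- The measure `dθ / 2π` on the interval from `0` to `2π`. -/
noncomputable def angle : Measure ℝ :=
  (ENNReal.ofReal (2 * Real.pi))⁻¹ • volume.restrict (Ioc 0 (2 * Real.pi))

/-- The point `r e^{iθ}`. -/
noncomputable def polar (r θ : ℝ) : ℂ := r * Complex.exp (θ * Complex.I)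

/-- The kernel `log |(1 - conj ζ w) / (w - ζ)|² / (1 - |ζ|²)` for `ζ`, `w` in the open disc,
with its value `∞` at `w = ζ`. -/
noncomputable def greenKernel (ζ w : ℂ) : ℝ≥0∞ :=
  open Classical in
  if w = ζ then ⊤
  else ENNReal.ofReal (Real.log (‖(1 - conj ζ * w) / (w - ζ)‖ ^ 2) / (1 - ‖ζ‖ ^ 2))

/-- The Poisson kernel `(1 - |w|²) / |ζ - w|²` for `ζ` on the circle, `w` in the open disc. -/
noncomputable def poissonKernel (ζ w : ℂ) : ℝ≥0∞ :=
  ENNReal.ofReal ((1 - ‖w‖ ^ 2) / ‖ζ - w‖ ^ 2)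

/-- The superharmonic weight `U_μ` on the open disc attached to a measure `μ` on the closed
disc. -/
noncomputable def weight (μ : Measure ClosedDisc) (w : ℂ) : ℝ≥0∞ :=
  (∫⁻ ζ in {ζ : ClosedDisc | ‖(ζ : ℂ)‖ < 1}, greenKernel ζ w ∂μ)
    + ∫⁻ ζ in {ζ : ClosedDisc | ‖(ζ : ℂ)‖ = 1}, poissonKernel ζ w ∂μ

/-- `sup_{0<r<1} ∫_0^{2π} ∫_𝔻 |∂₁ f(z, r e^{iθ})|² U_μ(z) dA(z) dθ/2π`. -/
noncomputable def sliceIntegral (μ : Measure ClosedDisc) (f : ℂ × ℂ → ℂ) : ℝ≥0∞ :=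
  ⨆ r ∈ Ioo (0 : ℝ) 1,
    ∫⁻ θ, ∫⁻ z, ‖deriv (fun w => f (w, polar r θ)) z‖ₑ ^ 2 * weight μ z ∂area ∂angle

/-- The Dirichlet integral `D_{μ₁, μ₂}(f)`. The second summand is
`sup_{0<r<1} ∫_0^{2π} ∫_𝔻 |∂₂ f(r e^{iθ}, z)|² U_{μ₂}(z) dA(z) dθ/2π`. -/
noncomputable def dirichletIntegral (μ₁ μ₂ : Measure ClosedDisc) (f : ℂ × ℂ → ℂ) : ℝ≥0∞ :=
  sliceIntegral μ₁ f + sliceIntegral μ₂ (fun z => f (z.2, z.1))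

/-- The squared norm of the Hardy space `H²` of the bidisc. -/
noncomputable def hardyNormSq (f : ℂ × ℂ → ℂ) : ℝ≥0∞ :=
  ⨆ r ∈ Ioo (0 : ℝ) 1, ∫⁻ α, ∫⁻ β, ‖f (polar r α, polar r β)‖ₑ ^ 2 ∂angle ∂angle

/-- The squared norm `‖f‖² = ‖f‖²_{H²} + D_{μ₁, μ₂}(f)` of the Dirichlet-type space. -/
noncomputable def normSq (μ₁ μ₂ : Measure ClosedDisc) (f : ℂ × ℂ → ℂ) : ℝ≥0∞ :=
  hardyNormSq f + dirichletIntegral μ₁ μ₂ f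

/-- A holomorphic function on the bidisc, represented by its extension by zero to `ℂ × ℂ`
(so that two of them are equal exactly when they agree on the bidisc). -/
structure IsHolo (f : ℂ × ℂ → ℂ) : Prop where
  diff : DifferentiableOn ℂ f bidisc
  zero_off : ∀ z, z ∉ bidisc → f z = 0

theorem isOpen_disc : IsOpen disc := Metric.isOpen_ball

theorem isOpen_bidisc : IsOpen bidisc := isOpen_disc.prod isOpen_disc

theorem polar_mem {r : ℝ} (hr : r ∈ Ioo (0 : ℝ) 1) (θ : ℝ) : polar r θ ∈ disc := by
  simp [polar, disc, Complex.norm_exp_ofReal_mul_I, abs_of_pos hr.1, hr.2]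

theorem continuous_polar (r : ℝ) : Continuous (polar r) := by
  unfold polar; fun_prop

theorem IsHolo.zero : IsHolo 0 := ⟨differentiableOn_const 0, fun _ _ => rfl⟩

theorem IsHolo.add {f g : ℂ × ℂ → ℂ} (hf : IsHolo f) (hg : IsHolo g) : IsHolo (f + g) :=
  ⟨hf.diff.add hg.diff, fun z hz => by simp [hf.zero_off z hz, hg.zero_off z hz]⟩

theorem IsHolo.smul {f : ℂ × ℂ → ℂ} (c : ℂ) (hf : IsHolo f) : IsHolo (c • f) :=
  ⟨hf.diff.const_smul c, fun z hz => by simp [hf.zero_off z hz]⟩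

theorem IsHolo.swap {f : ℂ × ℂ → ℂ} (hf : IsHolo f) : IsHolo (fun z => f (z.2, z.1)) :=
  ⟨hf.diff.comp (f := fun z : ℂ × ℂ => (z.2, z.1)) (by fun_prop) (fun _ hz => ⟨hz.2, hz.1⟩),
    fun _ hz => hf.zero_off _ (fun h => hz ⟨h.2, h.1⟩)⟩

theorem IsHolo.measurable {f : ℂ × ℂ → ℂ} (hf : IsHolo f) : Measurable f := by
  classical
  have h : f = bidisc.piecewise f (fun _ => 0) := by
    ext z
    by_cases hz : z ∈ bidisc
    · simp [hz]
    · simp [hz, hf.zero_off z hz]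
  rw [h]
  exact hf.diff.continuousOn.measurable_piecewise continuousOn_const
    isOpen_bidisc.measurableSet

theorem IsHolo.differentiableAt_slice {f : ℂ × ℂ → ℂ} (hf : IsHolo f) {z v : ℂ}
    (hz : z ∈ disc) (hv : v ∈ disc) : DifferentiableAt ℂ (fun w => f (w, v)) z := by
  have h : DifferentiableAt ℂ f (z, v) :=
    (hf.diff (z, v) ⟨hz, hv⟩).differentiableAt (isOpen_bidisc.mem_nhds ⟨hz, hv⟩)
  exact h.comp z (f := fun w : ℂ => (w, v)) (by fun_prop)

theorem IsHolo.measurable_deriv {f : ℂ × ℂ → ℂ} (hf : IsHolo f) :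
    Measurable (bidisc.indicator fun z : ℂ × ℂ => deriv (fun w => f (w, z.2)) z.1) := by
  have hm := hf.measurable
  let e : ℕ → ℂ := fun n => 1 / ((n : ℂ) + 1)
  refine measurable_of_tendsto_metrizable
    (f := fun n => bidisc.indicator
      fun z : ℂ × ℂ => (e n)⁻¹ • (f (z.1 + e n, z.2) - f (z.1, z.2))) (fun n => ?_) ?_
  · refine Measurable.indicator ?_ isOpen_bidisc.measurableSet
    have h1 : Measurable fun z : ℂ × ℂ => f (z.1 + e n, z.2) := hm.comp (by fun_prop)
    have h2 : Measurable fun z : ℂ × ℂ => f (z.1, z.2) := hm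
    exact (h1.sub h2).const_smul (e n)⁻¹
  · rw [tendsto_pi_nhds]
    intro z
    by_cases hz : z ∈ bidisc
    · simp only [indicator_of_mem hz]
      have hd := (hf.differentiableAt_slice hz.1 hz.2).hasDerivAt.tendsto_slope_zero
      refine hd.comp (tendsto_nhdsWithin_iff.2 ⟨tendsto_one_div_add_atTop_nhds_zero_nat, ?_⟩)
      exact Eventually.of_forall fun n => one_div_ne_zero (Nat.cast_add_one_ne_zero n)
    · simp only [indicator_of_notMem hz]
      exact tendsto_const_nhds

theorem measurable_weight (μ : Measure ClosedDisc) [IsFiniteMeasure μ] :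
    Measurable (weight μ) := by
  classical
  have h1 : Measurable fun p : ℂ × ClosedDisc => greenKernel (p.2 : ℂ) p.1 := by
    unfold greenKernel
    refine Measurable.ite (measurableSet_eq_fun measurable_fst (by fun_prop))
      measurable_const ?_
    refine ENNReal.measurable_ofReal.comp (Measurable.div (Real.measurable_log.comp ?_) ?_)
    · refine (Measurable.norm (Measurable.div (measurable_const.sub
        (Measurable.mul ?_ measurable_fst)) (by fun_prop))).pow_const 2
      exact Complex.continuous_conj.measurable.comp (by fun_prop)
    · fun_prop
  have h2 : Measurable fun p : ℂ × ClosedDisc => poissonKernel (p.2 : ℂ) p.1 := by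
    unfold poissonKernel
    fun_prop
  exact h1.lintegral_prod_right'.add h2.lintegral_prod_right'

theorem enorm_add_sq_le (a b : ℂ) : ‖a + b‖ₑ ^ 2 ≤ 2 * ‖a‖ₑ ^ 2 + 2 * ‖b‖ₑ ^ 2 := by
  have h : ‖a + b‖₊ ^ 2 ≤ 2 * ‖a‖₊ ^ 2 + 2 * ‖b‖₊ ^ 2 := by
    rw [← NNReal.coe_le_coe]
    push_cast
    nlinarith [norm_add_le a b, norm_nonneg (a + b), sq_nonneg (‖a‖ - ‖b‖),
      norm_nonneg a, norm_nonneg b]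
  simp only [enorm_eq_nnnorm]
  exact_mod_cast h

theorem ae_area_mem : ∀ᵐ z ∂area, z ∈ disc :=
  Measure.ae_smul_measure (ae_restrict_mem isOpen_disc.measurableSet) _

instance : SFinite area := by unfold area; infer_instance
instance : SFinite angle := by unfold angle; infer_instance

/-- A jointly measurable version of the integrand of `sliceIntegral`. -/
noncomputable def sliceDensity (μ : Measure ClosedDisc) (f : ℂ × ℂ → ℂ) (z : ℂ × ℂ) : ℝ≥0∞ :=
  ‖bidisc.indicator (fun z : ℂ × ℂ => deriv (fun w => f (w, z.2)) z.1) z‖ₑ ^ 2 * weight μ z.1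

theorem measurable_sliceDensity (μ : Measure ClosedDisc) [IsFiniteMeasure μ]
    {f : ℂ × ℂ → ℂ} (hf : IsHolo f) : Measurable (sliceDensity μ f) :=
  (hf.measurable_deriv.enorm.pow_const 2).mul ((measurable_weight μ).comp measurable_fst)

theorem sliceIntegral_eq (μ : Measure ClosedDisc) (f : ℂ × ℂ → ℂ) :
    sliceIntegral μ f
      = ⨆ r ∈ Ioo (0 : ℝ) 1, ∫⁻ θ, ∫⁻ z, sliceDensity μ f (z, polar r θ) ∂area ∂angle := by
  unfold sliceIntegral
  refine iSup_congr fun r => iSup_congr fun hr => lintegral_congr fun θ => lintegral_congr_ae ?_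
  filter_upwards [ae_area_mem] with z hz
  have : (z, polar r θ) ∈ bidisc := ⟨hz, polar_mem hr θ⟩
  simp [sliceDensity, this]

theorem sliceDensity_add_le (μ : Measure ClosedDisc) {f g : ℂ × ℂ → ℂ}
    (hf : IsHolo f) (hg : IsHolo g) (z : ℂ × ℂ) :
    sliceDensity μ (f + g) z ≤ 2 * sliceDensity μ f z + 2 * sliceDensity μ g z := by
  by_cases hz : z ∈ bidisc
  · simp only [sliceDensity, indicator_of_mem hz]
    have : deriv (fun w => (f + g) (w, z.2)) z.1
        = deriv (fun w => f (w, z.2)) z.1 + deriv (fun w => g (w, z.2)) z.1 :=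
      deriv_fun_add (hf.differentiableAt_slice hz.1 hz.2) (hg.differentiableAt_slice hz.1 hz.2)
    rw [this, ← mul_assoc, ← mul_assoc, ← add_mul]
    gcongr
    exact enorm_add_sq_le _ _
  · simp [sliceDensity, hz]

theorem sliceIntegral_add_le (μ : Measure ClosedDisc) [IsFiniteMeasure μ] {f g : ℂ × ℂ → ℂ}
    (hf : IsHolo f) (hg : IsHolo g) :
    sliceIntegral μ (f + g) ≤ 2 * sliceIntegral μ f + 2 * sliceIntegral μ g := by
  have hF := measurable_sliceDensity μ hf
  have hG := measurable_sliceDensity μ hg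
  simp only [sliceIntegral_eq]
  refine iSup₂_le fun r hr => ?_
  have key : ∀ {k : ℂ × ℂ → ℝ≥0∞}, Measurable k →
      Measurable fun p : ℝ × ℂ => k (p.2, polar r p.1) := fun hk =>
    hk.comp (measurable_snd.prodMk ((continuous_polar r).measurable.comp measurable_fst))
  calc ∫⁻ θ, ∫⁻ z, sliceDensity μ (f + g) (z, polar r θ) ∂area ∂angle
      ≤ ∫⁻ θ, ∫⁻ z, (2 * sliceDensity μ f (z, polar r θ)
          + 2 * sliceDensity μ g (z, polar r θ)) ∂area ∂angle :=
        lintegral_mono fun θ => lintegral_mono fun z => sliceDensity_add_le μ hf hg _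
    _ = ∫⁻ θ, (2 * ∫⁻ z, sliceDensity μ f (z, polar r θ) ∂area)
          + 2 * ∫⁻ z, sliceDensity μ g (z, polar r θ) ∂area ∂angle := by
        refine lintegral_congr fun θ => ?_
        have hf' : Measurable fun z => sliceDensity μ f (z, polar r θ) :=
          hF.comp measurable_prodMk_right
        have hg' : Measurable fun z => sliceDensity μ g (z, polar r θ) :=
          hG.comp measurable_prodMk_right
        rw [lintegral_add_left (hf'.const_mul 2), lintegral_const_mul _ hf',
          lintegral_const_mul _ hg']
    _ = 2 * (∫⁻ θ, ∫⁻ z, sliceDensity μ f (z, polar r θ) ∂area ∂angle)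
          + 2 * ∫⁻ θ, ∫⁻ z, sliceDensity μ g (z, polar r θ) ∂area ∂angle := by
        have hf' := (key hF).lintegral_prod_right' (ν := area)
        have hg' := (key hG).lintegral_prod_right' (ν := area)
        rw [lintegral_add_left (hf'.const_mul 2), lintegral_const_mul _ hf',
          lintegral_const_mul _ hg']
    _ ≤ _ := by
        gcongr
        · exact le_iSup₂_of_le r hr le_rfl
        · exact le_iSup₂_of_le r hr le_rfl

theorem sliceIntegral_smul (μ : Measure ClosedDisc) (c : ℂ) (f : ℂ × ℂ → ℂ) :
    sliceIntegral μ (c • f) = ‖c‖ₑ ^ 2 * sliceIntegral μ f := by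
  have hc : ‖c‖ₑ ^ 2 ≠ ⊤ := by simp
  simp only [sliceIntegral, ENNReal.mul_iSup]
  refine iSup_congr fun r => iSup_congr fun _ => ?_
  rw [← lintegral_const_mul' _ _ hc]
  refine lintegral_congr fun θ => ?_
  rw [← lintegral_const_mul' _ _ hc]
  refine lintegral_congr fun z => ?_
  have : deriv (fun w => (c • f) (w, polar r θ)) z = c * deriv (fun w => f (w, polar r θ)) z := by
    simp [deriv_const_mul_field]
  rw [this, enorm_mul, mul_pow, mul_assoc]

theorem hardyNormSq_add_le {f g : ℂ × ℂ → ℂ} (hf : IsHolo f) (hg : IsHolo g) :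
    hardyNormSq (f + g) ≤ 2 * hardyNormSq f + 2 * hardyNormSq g := by
  have hF := hf.measurable.enorm.pow_const 2
  have hG := hg.measurable.enorm.pow_const 2
  refine iSup₂_le fun r hr => ?_
  have hp := (continuous_polar r).measurable
  have key : ∀ {k : ℂ × ℂ → ℝ≥0∞}, Measurable k →
      Measurable fun p : ℝ × ℝ => k (polar r p.1, polar r p.2) := fun hk =>
    hk.comp ((hp.comp measurable_fst).prodMk (hp.comp measurable_snd))
  calc ∫⁻ α, ∫⁻ β, ‖(f + g) (polar r α, polar r β)‖ₑ ^ 2 ∂angle ∂angle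
      ≤ ∫⁻ α, ∫⁻ β, (2 * ‖f (polar r α, polar r β)‖ₑ ^ 2
          + 2 * ‖g (polar r α, polar r β)‖ₑ ^ 2) ∂angle ∂angle :=
        lintegral_mono fun θ => lintegral_mono fun z => enorm_add_sq_le _ _
    _ = ∫⁻ α, (2 * ∫⁻ β, ‖f (polar r α, polar r β)‖ₑ ^ 2 ∂angle)
          + 2 * ∫⁻ β, ‖g (polar r α, polar r β)‖ₑ ^ 2 ∂angle ∂angle := by
        refine lintegral_congr fun α => ?_
        have hf' := (key hF).comp (measurable_prodMk_left (x := α))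
        have hg' := (key hG).comp (measurable_prodMk_left (x := α))
        simp only [Function.comp_def] at hf' hg'
        rw [lintegral_add_left (hf'.const_mul 2), lintegral_const_mul _ hf',
          lintegral_const_mul _ hg']
    _ = 2 * (∫⁻ α, ∫⁻ β, ‖f (polar r α, polar r β)‖ₑ ^ 2 ∂angle ∂angle)
          + 2 * ∫⁻ α, ∫⁻ β, ‖g (polar r α, polar r β)‖ₑ ^ 2 ∂angle ∂angle := by
        have hf' := (key hF).lintegral_prod_right' (ν := angle)
        have hg' := (key hG).lintegral_prod_right' (ν := angle)
        rw [lintegral_add_left (hf'.const_mul 2), lintegral_const_mul _ hf',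
          lintegral_const_mul _ hg']
    _ ≤ _ := by
        unfold hardyNormSq
        gcongr
        · exact le_iSup₂_of_le (f := fun (r : ℝ) (_ : r ∈ Ioo (0 : ℝ) 1) =>
            ∫⁻ α, ∫⁻ β, ‖f (polar r α, polar r β)‖ₑ ^ 2 ∂angle ∂angle) r hr le_rfl
        · exact le_iSup₂_of_le (f := fun (r : ℝ) (_ : r ∈ Ioo (0 : ℝ) 1) =>
            ∫⁻ α, ∫⁻ β, ‖g (polar r α, polar r β)‖ₑ ^ 2 ∂angle ∂angle) r hr le_rfl

theorem hardyNormSq_smul (c : ℂ) (f : ℂ × ℂ → ℂ) :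
    hardyNormSq (c • f) = ‖c‖ₑ ^ 2 * hardyNormSq f := by
  have hc : ‖c‖ₑ ^ 2 ≠ ⊤ := by simp
  simp only [hardyNormSq, ENNReal.mul_iSup]
  refine iSup_congr fun r => iSup_congr fun _ => ?_
  rw [← lintegral_const_mul' _ _ hc]
  refine lintegral_congr fun α => ?_
  rw [← lintegral_const_mul' _ _ hc]
  refine lintegral_congr fun β => ?_
  simp [enorm_mul, mul_pow]

theorem normSq_add_le (μ₁ μ₂ : Measure ClosedDisc) [IsFiniteMeasure μ₁] [IsFiniteMeasure μ₂]
    {f g : ℂ × ℂ → ℂ} (hf : IsHolo f) (hg : IsHolo g) :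
    normSq μ₁ μ₂ (f + g) ≤ 2 * normSq μ₁ μ₂ f + 2 * normSq μ₁ μ₂ g := by
  have h1 := hardyNormSq_add_le hf hg
  have h2 := sliceIntegral_add_le μ₁ hf hg
  have h3 := sliceIntegral_add_le μ₂ hf.swap hg.swap
  calc normSq μ₁ μ₂ (f + g) ≤ _ := add_le_add h1 (add_le_add h2 h3)
    _ = _ := by unfold normSq dirichletIntegral; ring

theorem normSq_smul (μ₁ μ₂ : Measure ClosedDisc) (c : ℂ) (f : ℂ × ℂ → ℂ) :
    normSq μ₁ μ₂ (c • f) = ‖c‖ₑ ^ 2 * normSq μ₁ μ₂ f := by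
  have h := sliceIntegral_smul μ₂ c (fun z => f (z.2, z.1))
  unfold normSq dirichletIntegral
  rw [hardyNormSq_smul, sliceIntegral_smul, mul_add, mul_add, ← h]
  rfl

/-- The Dirichlet-type space `D(μ₁, μ₂)`: the holomorphic functions on the bidisc that belong to
`H²` and have finite Dirichlet integral. Its squared norm is `normSq μ₁ μ₂`, which is finite
exactly when both of its summands are. -/
noncomputable def DirichletSpace (μ₁ μ₂ : Measure ClosedDisc)
    [IsFiniteMeasure μ₁] [IsFiniteMeasure μ₂] : Submodule ℂ (ℂ × ℂ → ℂ) where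
  carrier := {f | IsHolo f ∧ hardyNormSq f < ⊤ ∧ dirichletIntegral μ₁ μ₂ f < ⊤}
  zero_mem' := by
    have h := normSq_smul μ₁ μ₂ 0 0
    simp only [smul_zero, enorm_zero, ne_eq, OfNat.ofNat_ne_zero, not_false_eq_true, zero_pow,
      zero_mul] at h
    exact ⟨IsHolo.zero, ENNReal.add_lt_top.1 (h.trans_lt ENNReal.zero_lt_top)⟩
  add_mem' := by
    rintro f g ⟨hf, hf'⟩ ⟨hg, hg'⟩
    refine ⟨hf.add hg, ENNReal.add_lt_top.1 ((normSq_add_le μ₁ μ₂ hf hg).trans_lt ?_)⟩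
    exact ENNReal.add_lt_top.2
      ⟨ENNReal.mul_lt_top (by simp) (ENNReal.add_lt_top.2 hf'),
        ENNReal.mul_lt_top (by simp) (ENNReal.add_lt_top.2 hg')⟩
  smul_mem' := by
    rintro c f ⟨hf, hf'⟩
    refine ⟨hf.smul c, ENNReal.add_lt_top.1 ((normSq_smul μ₁ μ₂ c f).trans_lt ?_)⟩
    exact ENNReal.mul_lt_top (by simp) (ENNReal.add_lt_top.2 hf')

/-- Unitary equivalence of the pair of multiplications by the coordinate functions on
`D(μ₁, μ₂)` with that on `D(ν₁, ν₂)`: there is a unitary map `U` (a linear bijection that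
preserves the norm) such that, for every `f` in `D(μ₁, μ₂)` and `j = 1, 2`, the function `z_j f`
belongs to `D(μ₁, μ₂)` and `U (z_j f) = z_j (U f)`. -/
def UnitarilyEquivalent (μ₁ μ₂ ν₁ ν₂ : Measure ClosedDisc)
    [IsFiniteMeasure μ₁] [IsFiniteMeasure μ₂] [IsFiniteMeasure ν₁] [IsFiniteMeasure ν₂] : Prop :=
  ∃ U : DirichletSpace μ₁ μ₂ ≃ₗ[ℂ] DirichletSpace ν₁ ν₂,
    (∀ f : DirichletSpace μ₁ μ₂, normSq ν₁ ν₂ (U f) = normSq μ₁ μ₂ f) ∧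
    (∀ f : DirichletSpace μ₁ μ₂, ∃ h : (fun z => z.1 * f.1 z) ∈ DirichletSpace μ₁ μ₂,
      (U ⟨fun z => z.1 * f.1 z, h⟩).1 = fun z => z.1 * (U f).1 z) ∧
    (∀ f : DirichletSpace μ₁ μ₂, ∃ h : (fun z => z.2 * f.1 z) ∈ DirichletSpace μ₁ μ₂,
      (U ⟨fun z => z.2 * f.1 z, h⟩).1 = fun z => z.2 * (U f).1 z)

end DirichletBidisc

namespace DirichletBidisc

/-! The weight is recovered from the action of multiplication on one-variable polynomials. Let
`D_ζ(f)` be the integral of `|f'|²` against the kernel of `U_μ` at `ζ`, so that the weighted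
Dirichlet integral `D_μ(f)` is `∫ D_ζ(f) dμ(ζ)`. For `ζ` in the disc and `φ_ζ` the involution
exchanging `0` and `ζ`, Littlewood–Paley gives `‖f ∘ φ_ζ‖² = |f(ζ)|² + (1 - |ζ|²) D_ζ(f)` in `H²`.
Multiplication by `φ_ζ` is isometric on `H²`, hence `D_ζ(zf) = D_ζ(f) + |f(ζ)|²`
(`localDirichlet_id_mul_of_mem`). For polynomials this extends to the circle by a radial limit, so
`D_μ(zp) - D_μ(p) = ∫ |p|² dμ`. By polarization and Stone–Weierstrass these numbers determine `μ`
(`measure_eq_of_weightedDirichlet_eq`).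

It remains to see that a unitary `U` intertwining the two pairs preserves `D_{μ_j}(p)`. Constants
are orthogonal to the functions vanishing at the origin (`normSq_const_add`), and these are exactly
`z₁D + z₂D`, because division by a coordinate stays in the space (`exists_eq_fst_mul_add_snd_mul`).
As `U` respects this ideal, `U1` is a constant `c` of modulus one (`exists_map_one_eq`). Then `U
p(z_j) = c p(z_j)`, and cancelling the Hardy norms leaves the equality of the Dirichlet integrals.

For the converse, the identity map serves once multiplication by `z_j` preserves the space; the same
local formula gives the estimates for multiplication and division. -/

/-! ### Mean squares on circles and the Hardy space of the disc. -/

/-- The mean square of `F` over the circle of radius `r` around the origin. -/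
noncomputable def circleMean (F : ℂ → ℂ) (r : ℝ) : ℝ≥0∞ := ∫⁻ θ, ‖F (polar r θ)‖ₑ ^ 2 ∂angle

/-- The squared `H²` norm of a function on the disc. -/
noncomputable def hardySq (F : ℂ → ℂ) : ℝ≥0∞ := ⨆ r ∈ Ioo (0 : ℝ) 1, circleMean F r

/-- The `n`-th Taylor coefficient at the origin. -/
noncomputable def taylorCoeff (F : ℂ → ℂ) (n : ℕ) : ℂ := (n.factorial : ℂ)⁻¹ * iteratedDeriv n F 0

theorem lintegral_angle (f : ℝ → ℝ≥0∞) :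
    ∫⁻ θ, f θ ∂angle
      = (ENNReal.ofReal (2 * Real.pi))⁻¹ * ∫⁻ θ in Ioc 0 (2 * Real.pi), f θ := by
  simp [angle]

instance : IsProbabilityMeasure angle := ⟨by
  have : ENNReal.ofReal (2 * Real.pi) ≠ 0 := by simp [Real.pi_pos]
  simp only [angle, Measure.smul_apply, Measure.restrict_apply_univ, Real.volume_Ioc, sub_zero,
    smul_eq_mul]
  exact ENNReal.inv_mul_cancel this ENNReal.ofReal_ne_top⟩

theorem norm_polar (r θ : ℝ) : ‖polar r θ‖ = |r| := by
  simp [polar, Complex.norm_exp_ofReal_mul_I]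

theorem mem_disc {z : ℂ} : z ∈ disc ↔ ‖z‖ < 1 := by simp [disc]

theorem polar_eq_mul (r θ : ℝ) : polar r θ = r * polar 1 θ := by simp [polar]

theorem polar_periodic (r : ℝ) : Function.Periodic (polar r) (2 * Real.pi) := fun θ => by
  simp only [polar]
  push_cast
  rw [add_mul, Complex.exp_periodic]

/-- Bridge to `Real.circleAverage`, for which Parseval's identity for polynomials is stated. -/
theorem lintegral_angle_ofReal {g : ℂ → ℝ} (hg : Continuous g) (h0 : ∀ z, 0 ≤ g z) :
    ∫⁻ θ, ENNReal.ofReal (g (polar 1 θ)) ∂angle = ENNReal.ofReal (Real.circleAverage g 0 1) := by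
  have hc : Continuous fun θ => g (polar 1 θ) := hg.comp (continuous_polar 1)
  have hpc : ∀ θ, circleMap 0 1 θ = polar 1 θ := fun θ => by simp [polar, circleMap]
  rw [lintegral_angle, Real.circleAverage, smul_eq_mul,
    ENNReal.ofReal_mul (p := (2 * Real.pi)⁻¹) (by positivity),
    ENNReal.ofReal_inv_of_pos (by positivity),
    intervalIntegral.integral_of_le (by positivity)]
  simp only [hpc]
  rw [ofReal_integral_eq_lintegral_ofReal ((hc.integrableOn_Icc).mono_set Ioc_subset_Icc_self)
    (Eventually.of_forall fun _ => h0 _)]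

theorem enorm_sq_eq_ofReal (z : ℂ) : ‖z‖ₑ ^ 2 = ENNReal.ofReal (‖z‖ ^ 2) := by
  rw [ENNReal.ofReal_pow (norm_nonneg _), ofReal_norm]

/-- Parseval's identity on the circle of radius `r`. -/
theorem circleMean_eq_tsum {F : ℂ → ℂ} {c : ℕ → ℂ}
    (hF : ∀ w ∈ disc, HasSum (fun n => c n * w ^ n) (F w)) {r : ℝ} (hr : r ∈ Ioo (0 : ℝ) 1) :
    circleMean F r = ∑' n, ‖c n‖ₑ ^ 2 * ENNReal.ofReal (r ^ (2 * n)) := by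
  set d : ℕ → ℂ := fun n => c n * (r : ℂ) ^ n with hd
  have hrd : (r : ℂ) ∈ disc := by
    rw [mem_disc]; simpa [abs_of_pos hr.1] using hr.2
  have hsum : Summable fun n => ‖d n‖ := (hF r hrd).summable.norm
  -- The radius is absorbed into `d`, so that partial sums on the circle of radius `r` become
  -- polynomials on the unit circle.
  let p : ℕ → Polynomial ℂ := fun N => ∑ n ∈ Finset.range N, Polynomial.monomial n (d n)
  have hev : ∀ N z, (p N).eval z = ∑ n ∈ Finset.range N, d n * z ^ n := fun N z => by
    simp [p, Polynomial.eval_finsetSum]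
  have hcoeff : ∀ N i, (p N).coeff i = if i < N then d i else 0 := fun N i => by
    simp [p, Polynomial.coeff_monomial]
  have hpars : ∀ N, ∫⁻ θ, ‖(p N).eval (polar 1 θ)‖ₑ ^ 2 ∂angle
      = ∑ n ∈ Finset.range N, ‖d n‖ₑ ^ 2 := fun N => by
    simp only [enorm_sq_eq_ofReal]
    rw [lintegral_angle_ofReal (g := fun z => ‖(p N).eval z‖ ^ 2) (by fun_prop)
      (fun _ => by positivity), ← Polynomial.sum_sq_norm_coeff_eq_circleAverage,
      ← ENNReal.ofReal_sum_of_nonneg (fun _ _ => by positivity)]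
    congr 1
    rw [Finset.sum_subset (s₂ := Finset.range N)]
    · refine Finset.sum_congr rfl fun i hi => ?_
      rw [hcoeff, if_pos (Finset.mem_range.1 hi)]
    · intro i hi
      by_contra h
      simp only [Polynomial.mem_support_iff, hcoeff] at hi
      simp only [Finset.mem_range] at h
      simp [h] at hi
    · intro i _ hi
      simp only [Polynomial.mem_support_iff, not_not] at hi
      simp [hi]
  have hlim : Tendsto (fun N => ∫⁻ θ, ‖(p N).eval (polar 1 θ)‖ₑ ^ 2 ∂angle) atTop
      (𝓝 (circleMean F r)) := by
    refine tendsto_lintegral_of_dominated_convergence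
      (fun _ => ENNReal.ofReal ((∑' n, ‖d n‖) ^ 2)) (fun N => ?_) (fun N => ?_) ?_ ?_
    · have : Continuous fun θ => ‖(p N).eval (polar 1 θ)‖ₑ ^ 2 :=
        (ENNReal.continuous_pow 2).comp ((p N).continuous.comp (continuous_polar 1)).enorm
      exact this.measurable
    · refine Eventually.of_forall fun θ => ?_
      beta_reduce
      rw [enorm_sq_eq_ofReal]
      refine ENNReal.ofReal_le_ofReal (pow_le_pow_left₀ (norm_nonneg _) ?_ 2)
      rw [hev]
      refine (norm_sum_le _ _).trans ?_
      refine le_trans (Finset.sum_le_sum fun n _ => ?_)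
        (hsum.sum_le_tsum (Finset.range N) fun _ _ => norm_nonneg _)
      simp [norm_polar]
    · simp
    · refine Eventually.of_forall fun θ => ?_
      have h1 := (hF (polar r θ) (polar_mem hr θ)).tendsto_sum_nat
      have h2 : (fun N => ∑ n ∈ Finset.range N, c n * polar r θ ^ n)
          = fun N => (p N).eval (polar 1 θ) := by
        ext N
        rw [hev]
        refine Finset.sum_congr rfl fun n _ => ?_
        rw [polar_eq_mul, mul_pow, hd]; ring
      rw [h2] at h1
      exact ((ENNReal.continuous_pow 2).tendsto _).comp h1.enorm
  simp only [hpars] at hlim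
  rw [tendsto_nhds_unique hlim (ENNReal.summable.hasSum.tendsto_sum_nat)]
  refine tsum_congr fun n => ?_
  rw [hd, enorm_mul, mul_pow, enorm_sq_eq_ofReal ((r : ℂ) ^ n)]
  simp [← pow_mul, abs_of_pos hr.1, mul_comm]

theorem hasSum_taylorCoeff {F : ℂ → ℂ} (hF : DifferentiableOn ℂ F disc) :
    ∀ w ∈ disc, HasSum (fun n => taylorCoeff F n * w ^ n) (F w) := fun w hw => by
  have := Complex.hasSum_taylorSeries_on_ball (c := 0) (r := 1) hF hw
  refine this.congr_fun fun n => ?_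
  simp [taylorCoeff]; ring

theorem taylorCoeff_zero (F : ℂ → ℂ) : taylorCoeff F 0 = F 0 := by simp [taylorCoeff]

theorem taylorCoeff_deriv (F : ℂ → ℂ) (n : ℕ) :
    taylorCoeff (deriv F) n = (n + 1) * taylorCoeff F (n + 1) := by
  simp only [taylorCoeff, iteratedDeriv_succ', Nat.factorial_succ]
  have h1 : (n.factorial : ℂ) ≠ 0 := by exact_mod_cast n.factorial_ne_zero
  have h2 : (n : ℂ) + 1 ≠ 0 := by exact_mod_cast n.succ_ne_zero
  push_cast
  field_simp

theorem circleMean_taylor {F : ℂ → ℂ} (hF : DifferentiableOn ℂ F disc) {r : ℝ}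
    (hr : r ∈ Ioo (0 : ℝ) 1) :
    circleMean F r = ∑' n, ‖taylorCoeff F n‖ₑ ^ 2 * ENNReal.ofReal (r ^ (2 * n)) :=
  circleMean_eq_tsum (hasSum_taylorCoeff hF) hr

theorem circleMean_mono {F : ℂ → ℂ} (hF : DifferentiableOn ℂ F disc) {r s : ℝ}
    (hr : r ∈ Ioo (0 : ℝ) 1) (hs : s ∈ Ioo (0 : ℝ) 1) (h : r ≤ s) :
    circleMean F r ≤ circleMean F s := by
  rw [circleMean_taylor hF hr, circleMean_taylor hF hs]
  refine ENNReal.tsum_le_tsum fun n => ?_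
  gcongr
  exact hr.1.le

theorem enorm_zero_sq_le_circleMean {F : ℂ → ℂ} (hF : DifferentiableOn ℂ F disc) {r : ℝ}
    (hr : r ∈ Ioo (0 : ℝ) 1) : ‖F 0‖ₑ ^ 2 ≤ circleMean F r := by
  rw [circleMean_taylor hF hr]
  refine le_trans (le_of_eq ?_) (ENNReal.le_tsum 0)
  simp [taylorCoeff_zero]

/-- Means increase with the radius, so the supremum is a limit. -/
theorem tendsto_circleMean {F : ℂ → ℂ} (hF : DifferentiableOn ℂ F disc) :
    Tendsto (circleMean F) (𝓝[<] 1) (𝓝 (hardySq F)) := by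
  refine tendsto_order.2 ⟨fun a ha => ?_, fun a ha => ?_⟩
  · obtain ⟨r, hr⟩ := lt_iSup_iff.1 ha
    obtain ⟨hr1, hr2⟩ := lt_iSup_iff.1 hr
    filter_upwards [Ioo_mem_nhdsLT hr1.2] with s hs
    exact hr2.trans_le (circleMean_mono hF hr1 ⟨hr1.1.trans hs.1, hs.2⟩ hs.1.le)
  · filter_upwards [Ioo_mem_nhdsLT (zero_lt_one' ℝ)] with s hs
    exact (le_iSup₂ (f := fun r (_ : r ∈ Ioo (0 : ℝ) 1) => circleMean F r) s hs).trans_lt ha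

theorem hardySq_taylor {F : ℂ → ℂ} (hF : DifferentiableOn ℂ F disc) :
    hardySq F = ∑' n, ‖taylorCoeff F n‖ₑ ^ 2 := by
  apply le_antisymm
  · refine iSup₂_le fun r hr => ?_
    rw [circleMean_taylor hF hr]
    refine ENNReal.tsum_le_tsum fun n => mul_le_of_le_one_right' ?_
    rw [← ENNReal.ofReal_one]
    exact ENNReal.ofReal_le_ofReal (pow_le_one₀ hr.1.le hr.2.le)
  · refine ENNReal.tsum_le_of_sum_range_le fun N => ?_
    have h1 : Tendsto (fun r : ℝ => ∑ n ∈ Finset.range N,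
        ‖taylorCoeff F n‖ₑ ^ 2 * ENNReal.ofReal (r ^ (2 * n))) (𝓝[<] 1)
        (𝓝 (∑ n ∈ Finset.range N, ‖taylorCoeff F n‖ₑ ^ 2 * ENNReal.ofReal (1 ^ (2 * n)))) := by
      refine Tendsto.mono_left ?_ nhdsWithin_le_nhds
      refine tendsto_finsetSum _ fun n _ => ?_
      refine ENNReal.Tendsto.const_mul ?_ (Or.inr (by simp))
      exact ENNReal.tendsto_ofReal ((continuous_pow (2 * n)).tendsto 1)
    simp only [one_pow, ENNReal.ofReal_one, mul_one] at h1
    refine le_of_tendsto_of_tendsto h1 (tendsto_circleMean hF) ?_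
    filter_upwards [Ioo_mem_nhdsLT (zero_lt_one' ℝ)] with s hs
    rw [circleMean_taylor hF hs]
    exact ENNReal.sum_le_tsum _

/-! ### Polar coordinates and the Littlewood–Paley identity. -/

theorem lintegral_Ioo_eq_Ioc_of_periodic {g : ℝ → ℝ≥0∞}
    (hp : Function.Periodic g (2 * Real.pi)) :
    ∫⁻ θ in Ioo (-Real.pi) Real.pi, g θ = ∫⁻ θ in Ioc 0 (2 * Real.pi), g θ := by
  have : Fact (0 < 2 * Real.pi) := ⟨by positivity⟩
  have hm : ∀ θ : ℝ, hp.lift (θ : AddCircle (2 * Real.pi)) = g θ := fun θ => hp.lift_coe θ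
  have h1 := AddCircle.lintegral_preimage (2 * Real.pi) (-Real.pi) hp.lift
  have h2 := AddCircle.lintegral_preimage (2 * Real.pi) 0 hp.lift
  simp only [hm] at h1 h2
  rw [zero_add] at h2
  rw [h2, ← h1, show -Real.pi + 2 * Real.pi = Real.pi by ring]
  exact setLIntegral_congr Ioo_ae_eq_Ioc

/-- Integration over the disc in polar coordinates. -/
theorem lintegral_area_polar {k : ℂ → ℝ≥0∞} (hk : Measurable k) :
    ∫⁻ w, k w ∂area
      = ∫⁻ r in Ioo (0 : ℝ) 1, ENNReal.ofReal (2 * r) * ∫⁻ θ, k (polar r θ) ∂angle := by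
  have hmeas : Measurable fun p : ℝ × ℝ => polar p.1 p.2 := by unfold polar; fun_prop
  have hd : MeasurableSet disc := isOpen_disc.measurableSet
  rw [area, lintegral_smul_measure, ← lintegral_indicator hd,
    ← Complex.lintegral_comp_polarCoord_symm, polarCoord_target, Measure.volume_eq_prod,
    ← Measure.prod_restrict]
  have hsymm : ∀ p : ℝ × ℝ, Complex.polarCoord.symm p = polar p.1 p.2 := fun p => by
    simp [polar, Complex.exp_mul_I]
  simp only [hsymm, smul_eq_mul]
  rw [lintegral_prod _ (by
    refine Measurable.aemeasurable (Measurable.mul (by fun_prop) ?_)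
    exact (hk.indicator hd).comp hmeas)]
  rw [← lintegral_const_mul' _ _ (by simpa using Real.pi_pos),
    ← lintegral_indicator measurableSet_Ioi, ← lintegral_indicator measurableSet_Ioo]
  refine lintegral_congr fun r => ?_
  by_cases h0 : 0 < r
  · rw [indicator_of_mem (mem_Ioi.2 h0)]
    by_cases h1 : r < 1
    · rw [indicator_of_mem (mem_Ioo.2 ⟨h0, h1⟩)]
      have hmem : ∀ θ, polar r θ ∈ disc := polar_mem ⟨h0, h1⟩
      simp only [indicator_of_mem (hmem _)]
      have hm : Measurable fun θ => k (polar r θ) := hk.comp (continuous_polar r).measurable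
      rw [lintegral_const_mul _ hm, lintegral_Ioo_eq_Ioc_of_periodic
        (fun θ => by simp only [polar_periodic r θ]), lintegral_angle, ← mul_assoc, ← mul_assoc]
      congr 1
      rw [ENNReal.ofReal_mul zero_le_two, ENNReal.ofReal_mul zero_le_two,
        ENNReal.mul_inv (by simp) (by simp), mul_comm (ENNReal.ofReal 2), mul_assoc,
        ← mul_assoc (ENNReal.ofReal 2), ENNReal.mul_inv_cancel (by simp) (by simp), one_mul,
        mul_comm]
    · rw [indicator_of_notMem (fun h => h1 h.2)]
      have hmem : ∀ θ, polar r θ ∉ disc := fun θ h => by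
        rw [mem_disc, norm_polar, abs_of_pos h0] at h
        exact h1 h
      simp [indicator_of_notMem (hmem _)]
  · rw [indicator_of_notMem (mt mem_Ioi.1 h0), indicator_of_notMem (fun h => h0 h.1)]

theorem differentiableOn_deriv {F : ℂ → ℂ} (hF : DifferentiableOn ℂ F disc) :
    DifferentiableOn ℂ (deriv F) disc := hF.deriv isOpen_disc

/-- The area integral of `|F'|²` against a radial weight in terms of Taylor coefficients. -/
theorem lintegral_deriv_sq_mul_radial {F : ℂ → ℂ} (hF : DifferentiableOn ℂ F disc)
    {u : ℝ → ℝ≥0∞} (hu : Measurable u) :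
    ∫⁻ w, ‖deriv F w‖ₑ ^ 2 * u ‖w‖ ∂area
      = ∑' n : ℕ, ‖taylorCoeff F (n + 1)‖ₑ ^ 2 * ((n + 1 : ℕ) ^ 2 *
          ∫⁻ r in Ioo (0 : ℝ) 1, ENNReal.ofReal (2 * r ^ (2 * n + 1)) * u r) := by
  rw [lintegral_area_polar (k := fun w => ‖deriv F w‖ₑ ^ 2 * u ‖w‖)
    (((measurable_deriv F).enorm.pow_const 2).mul (hu.comp measurable_norm))]
  have : ∀ r ∈ Ioo (0 : ℝ) 1, ENNReal.ofReal (2 * r) *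
      ∫⁻ θ, ‖deriv F (polar r θ)‖ₑ ^ 2 * u ‖polar r θ‖ ∂angle
      = ∑' n : ℕ, ‖taylorCoeff F (n + 1)‖ₑ ^ 2 * (n + 1 : ℕ) ^ 2
          * (ENNReal.ofReal (2 * r ^ (2 * n + 1)) * u r) := by
    intro r hr
    simp only [norm_polar, abs_of_pos hr.1]
    have hm : Measurable fun θ => ‖deriv F (polar r θ)‖ₑ ^ 2 :=
      ((measurable_deriv F).comp (continuous_polar r).measurable).enorm.pow_const 2
    rw [lintegral_mul_const _ hm]
    change _ * (circleMean (deriv F) r * _) = _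
    rw [circleMean_taylor (differentiableOn_deriv hF) hr, ← ENNReal.tsum_mul_right,
      ← ENNReal.tsum_mul_left]
    refine tsum_congr fun n => ?_
    have h1 : ‖(n : ℂ) + 1‖ₑ = ((n + 1 : ℕ) : ℝ≥0∞) := by
      rw [← ofReal_norm, ← Nat.cast_succ, Complex.norm_natCast, ENNReal.ofReal_natCast]
    rw [taylorCoeff_deriv, enorm_mul, h1, show 2 * r ^ (2 * n + 1) = (2 * r) * r ^ (2 * n) by ring,
      ENNReal.ofReal_mul (p := 2 * r) (by linarith [hr.1])]
    ring
  rw [setLIntegral_congr_fun measurableSet_Ioo this, lintegral_tsum]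
  · refine tsum_congr fun n => ?_
    rw [lintegral_const_mul _ (by fun_prop), mul_assoc]
  · intro n
    exact (Measurable.const_mul (by fun_prop) _).aemeasurable

/-- A nonnegative derivative is automatically integrable, and only continuity of `G` is asked at the
endpoints; this admits the logarithmic weight. -/
theorem setLIntegral_ofReal_eq_sub {g G : ℝ → ℝ} (hc : ContinuousOn G (Icc 0 1))
    (hd : ∀ x ∈ Ioo (0 : ℝ) 1, HasDerivAt G (g x) x) (hg : ∀ x ∈ Ioo (0 : ℝ) 1, 0 ≤ g x) :
    ∫⁻ r in Ioo (0 : ℝ) 1, ENNReal.ofReal (g r) = ENNReal.ofReal (G 1 - G 0) := by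
  have hint := intervalIntegral.integrableOn_deriv_of_nonneg (a := 0) (b := 1)  hc hd hg
  have h1 := intervalIntegral.integral_eq_sub_of_hasDerivAt_of_le zero_le_one hc hd
    ((intervalIntegrable_iff_integrableOn_Ioc_of_le zero_le_one).2 hint)
  rw [← h1, intervalIntegral.integral_of_le zero_le_one, integral_Ioc_eq_integral_Ioo,
    ofReal_integral_eq_lintegral_ofReal (hint.mono_set Ioo_subset_Ioc_self)
      ((ae_restrict_iff' measurableSet_Ioo).2 (Eventually.of_forall hg))]

theorem lintegral_pow_mul_one_sub_sq (n : ℕ) :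
    ∫⁻ r in Ioo (0 : ℝ) 1, ENNReal.ofReal (2 * r ^ (2 * n + 1)) * ENNReal.ofReal (1 - r ^ 2)
      = ENNReal.ofReal (1 / ((n + 1) * (n + 2))) := by
  have h1 : ∀ r ∈ Ioo (0 : ℝ) 1, ENNReal.ofReal (2 * r ^ (2 * n + 1)) * ENNReal.ofReal (1 - r ^ 2)
      = ENNReal.ofReal (2 * r ^ (2 * n + 1) * (1 - r ^ 2)) := fun r hr => by
    rw [← ENNReal.ofReal_mul (by have := hr.1; positivity)]
  have hn1 : (n : ℝ) + 1 ≠ 0 := by positivity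
  have hn2 : (n : ℝ) + 2 ≠ 0 := by positivity
  rw [setLIntegral_congr_fun measurableSet_Ioo h1, setLIntegral_ofReal_eq_sub
    (G := fun r => r ^ (2 * n + 2) / (n + 1) - r ^ (2 * n + 4) / (n + 2))]
  · congr 1
    simp only [one_pow, ne_eq, Nat.add_eq_zero_iff, OfNat.ofNat_ne_zero, and_false,
      not_false_eq_true, zero_pow]
    field_simp
    ring
  · fun_prop
  · intro x _
    have := ((hasDerivAt_pow (2 * n + 2) x).div_const ((n : ℝ) + 1)).sub
      ((hasDerivAt_pow (2 * n + 4) x).div_const ((n : ℝ) + 2))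
    refine this.congr_deriv ?_
    simp only [show 2 * n + 2 - 1 = 2 * n + 1 by omega, show 2 * n + 4 - 1 = 2 * n + 3 by omega]
    push_cast
    field_simp
    ring
  · intro x hx
    have := hx.1
    have : x ^ 2 ≤ 1 := pow_le_one₀ hx.1.le hx.2.le
    have : 0 ≤ 1 - x ^ 2 := by linarith
    positivity

theorem lintegral_pow_mul_log (n : ℕ) :
    ∫⁻ r in Ioo (0 : ℝ) 1,
        ENNReal.ofReal (2 * r ^ (2 * n + 1)) * ENNReal.ofReal (-Real.log (r ^ 2))
      = ENNReal.ofReal (1 / (n + 1) ^ 2) := by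
  have h1 : ∀ r ∈ Ioo (0 : ℝ) 1,
      ENNReal.ofReal (2 * r ^ (2 * n + 1)) * ENNReal.ofReal (-Real.log (r ^ 2))
      = ENNReal.ofReal (2 * r ^ (2 * n + 1) * (-Real.log (r ^ 2))) := fun r hr => by
    rw [← ENNReal.ofReal_mul (by have := hr.1; positivity)]
  have hn1 : (n : ℝ) + 1 ≠ 0 := by positivity
  -- The factor `r * Real.log r` is kept together because it is continuous at `0`.
  rw [setLIntegral_congr_fun measurableSet_Ioo h1, setLIntegral_ofReal_eq_sub
    (G := fun r => r ^ (2 * n + 2) / (n + 1) ^ 2 - 2 / (n + 1) * (r ^ (2 * n + 1) *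
      (r * Real.log r)))]
  · congr 1
    simp
  · have := Real.continuous_mul_log
    fun_prop
  · intro x hx
    have hx0 : x ≠ 0 := hx.1.ne'
    have := ((hasDerivAt_pow (2 * n + 2) x).div_const (((n : ℝ) + 1) ^ 2)).sub
      (((hasDerivAt_pow (2 * n + 1) x).mul (Real.hasDerivAt_mul_log hx0)).const_mul
        (2 / ((n : ℝ) + 1)))
    refine this.congr_deriv ?_
    simp only [show 2 * n + 2 - 1 = 2 * n + 1 by omega, show 2 * n + 1 - 1 = 2 * n by omega,
      Real.log_pow]
    push_cast
    field_simp
    ring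
  · intro x hx
    have := hx.1
    have : Real.log (x ^ 2) ≤ 0 := Real.log_nonpos (by positivity) (pow_le_one₀ hx.1.le hx.2.le)
    have : 0 ≤ -Real.log (x ^ 2) := by linarith
    positivity

/-- The radial moments `1 / (n + 1)²` cancel exactly the factors `(n + 1)²` produced by
differentiation. -/
theorem lintegral_deriv_sq_mul_log {F : ℂ → ℂ} (hF : DifferentiableOn ℂ F disc) :
    ∫⁻ w, ‖deriv F w‖ₑ ^ 2 * ENNReal.ofReal (-Real.log (‖w‖ ^ 2)) ∂area
      = ∑' n : ℕ, ‖taylorCoeff F (n + 1)‖ₑ ^ 2 := by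
  rw [lintegral_deriv_sq_mul_radial hF (u := fun r => ENNReal.ofReal (-Real.log (r ^ 2)))
    (by fun_prop)]
  refine tsum_congr fun n => ?_
  rw [lintegral_pow_mul_log, ← ENNReal.ofReal_natCast, ← ENNReal.ofReal_pow (by positivity),
    ← ENNReal.ofReal_mul (by positivity)]
  have : ((n + 1 : ℕ) : ℝ) ^ 2 * (1 / (n + 1) ^ 2) = 1 := by push_cast; field_simp
  rw [this, ENNReal.ofReal_one, mul_one]

/-- The Littlewood–Paley identity. -/
theorem hardySq_eq {F : ℂ → ℂ} (hF : DifferentiableOn ℂ F disc) :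
    hardySq F = ‖F 0‖ₑ ^ 2
      + ∫⁻ w, ‖deriv F w‖ₑ ^ 2 * ENNReal.ofReal (-Real.log (‖w‖ ^ 2)) ∂area := by
  rw [hardySq_taylor hF, lintegral_deriv_sq_mul_log hF, tsum_eq_zero_add' ENNReal.summable,
    taylorCoeff_zero]

/-- No pointwise bound exists near `0`; the comparison is made coefficient by coefficient, where
`2(n + 1)/(n + 2) ≥ 1`. The constant `2` is forced by `n = 0`. -/
theorem lintegral_deriv_sq_mul_log_le {F : ℂ → ℂ} (hF : DifferentiableOn ℂ F disc) :
    ∫⁻ w, ‖deriv F w‖ₑ ^ 2 * ENNReal.ofReal (-Real.log (‖w‖ ^ 2)) ∂area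
      ≤ 2 * ∫⁻ w, ‖deriv F w‖ₑ ^ 2 * ENNReal.ofReal (1 - ‖w‖ ^ 2) ∂area := by
  rw [lintegral_deriv_sq_mul_log hF,
    lintegral_deriv_sq_mul_radial hF (u := fun r => ENNReal.ofReal (1 - r ^ 2)) (by fun_prop),
    ← ENNReal.tsum_mul_left]
  refine ENNReal.tsum_le_tsum fun n => ?_
  rw [mul_left_comm]
  refine le_mul_of_one_le_right' ?_
  rw [lintegral_pow_mul_one_sub_sq, ← ENNReal.ofReal_natCast, ← ENNReal.ofReal_pow (by positivity),
    ← ENNReal.ofReal_mul (by positivity), ← ENNReal.ofReal_ofNat,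
    ← ENNReal.ofReal_mul (by positivity), ENNReal.one_le_ofReal]
  push_cast
  have : (0 : ℝ) ≤ n := n.cast_nonneg
  rw [mul_one_div, mul_div_assoc', le_div_iff₀ (by positivity)]
  nlinarith

/-! ### Automorphisms of the disc and Littlewood–Paley at an arbitrary base point. -/

/-- The involutive automorphism of the disc exchanging `0` and `ζ`. -/
noncomputable def mobius (ζ v : ℂ) : ℂ := (ζ - v) / (1 - conj ζ * v)

theorem norm_sq_one_sub_conj_mul (ζ v : ℂ) :
    ‖1 - conj ζ * v‖ ^ 2 = ‖ζ - v‖ ^ 2 + (1 - ‖ζ‖ ^ 2) * (1 - ‖v‖ ^ 2) := by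
  simp only [Complex.sq_norm, Complex.normSq_apply, Complex.sub_re, Complex.sub_im, Complex.mul_re,
    Complex.mul_im, Complex.conj_re, Complex.conj_im, Complex.one_re, Complex.one_im]
  ring

theorem one_sub_conj_mul_ne_zero {ζ v : ℂ} (hζ : ‖ζ‖ ≤ 1) (hv : v ∈ disc) :
    1 - conj ζ * v ≠ 0 := by
  intro h
  rw [mem_disc] at hv
  have h1 : ‖conj ζ * v‖ = 1 := by rw [← sub_eq_zero.1 h]; simp
  rw [norm_mul, RCLike.norm_conj] at h1
  nlinarith [norm_nonneg ζ, norm_nonneg v]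

theorem one_sub_norm_sq_pos {ζ : ℂ} (hζ : ζ ∈ disc) : 0 < 1 - ‖ζ‖ ^ 2 := by
  rw [mem_disc] at hζ
  nlinarith [norm_nonneg ζ]

theorem one_sub_norm_mobius_sq {ζ v : ℂ} (hζ : ζ ∈ disc) (hv : v ∈ disc) :
    1 - ‖mobius ζ v‖ ^ 2 = (1 - ‖ζ‖ ^ 2) * (1 - ‖v‖ ^ 2) / ‖1 - conj ζ * v‖ ^ 2 := by
  have h := norm_ne_zero_iff.2 (one_sub_conj_mul_ne_zero (mem_disc.1 hζ).le hv)
  have h2 := norm_sq_one_sub_conj_mul ζ v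
  rw [mobius, norm_div, div_pow, eq_div_iff (by positivity), sub_mul,
    div_mul_cancel₀ _ (by positivity)]
  linarith

theorem mobius_mem {ζ v : ℂ} (hζ : ζ ∈ disc) (hv : v ∈ disc) : mobius ζ v ∈ disc := by
  have h := one_sub_norm_mobius_sq hζ hv
  have h0 := norm_pos_iff.2 (one_sub_conj_mul_ne_zero (mem_disc.1 hζ).le hv)
  have : 0 < 1 - ‖mobius ζ v‖ ^ 2 := by
    rw [h]
    have := one_sub_norm_sq_pos hζ
    have := one_sub_norm_sq_pos hv
    positivity
  rw [mem_disc]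
  nlinarith [norm_nonneg (mobius ζ v)]

theorem mobius_mobius {ζ v : ℂ} (hζ : ζ ∈ disc) (hv : v ∈ disc) :
    mobius ζ (mobius ζ v) = v := by
  have h := one_sub_conj_mul_ne_zero (mem_disc.1 hζ).le hv
  have h1 := one_sub_conj_mul_ne_zero (mem_disc.1 hζ).le (mobius_mem hζ hv)
  have hq : mobius ζ v * (1 - conj ζ * v) = ζ - v := div_mul_cancel₀ _ h
  rw [mobius, div_eq_iff h1]
  linear_combination -hq

theorem mobius_zero (ζ : ℂ) : mobius ζ 0 = ζ := by simp [mobius]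

theorem mobius_self (ζ : ℂ) : mobius ζ ζ = 0 := by simp [mobius]

theorem differentiableAt_mobius {ζ v : ℂ} (hζ : ζ ∈ disc) (hv : v ∈ disc) :
    DifferentiableAt ℂ (mobius ζ) v := by
  unfold mobius
  exact DifferentiableAt.div (by fun_prop) (by fun_prop)
    (one_sub_conj_mul_ne_zero (mem_disc.1 hζ).le hv)

theorem differentiableOn_comp_mobius {f : ℂ → ℂ} (hf : DifferentiableOn ℂ f disc) {ζ : ℂ}
    (hζ : ζ ∈ disc) : DifferentiableOn ℂ (fun v => f (mobius ζ v)) disc :=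
  hf.comp (fun _ hv => (differentiableAt_mobius hζ hv).differentiableWithinAt)
    fun _ hv => mobius_mem hζ hv

/-- The real Jacobian of a holomorphic map is the squared modulus of its derivative, the factor that
the chain rule puts on `|f'|²`. -/
theorem det_restrictScalars_toSpanSingleton (a : ℂ) :
    (((ContinuousLinearMap.toSpanSingleton ℂ a).restrictScalars ℝ : ℂ →L[ℝ] ℂ)).det
      = ‖a‖ ^ 2 := by
  have h : ((ContinuousLinearMap.toSpanSingleton ℂ a : ℂ →L[ℂ] ℂ) : ℂ →ₗ[ℂ] ℂ).det = a := by
    simp [LinearMap.det_ring]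
  rw [ContinuousLinearMap.det, ContinuousLinearMap.coe_restrictScalars,
    LinearMap.det_restrictScalars, h, Algebra.norm_complex_apply, Complex.sq_norm]

/-- Conformal invariance of the Dirichlet integral under the automorphisms of the disc. -/
theorem lintegral_deriv_sq_comp_mobius {f : ℂ → ℂ} (hf : DifferentiableOn ℂ f disc) {ζ : ℂ}
    (hζ : ζ ∈ disc) (k : ℂ → ℝ≥0∞) :
    ∫⁻ w, ‖deriv f w‖ₑ ^ 2 * k w ∂area
      = ∫⁻ v, ‖deriv (fun v => f (mobius ζ v)) v‖ₑ ^ 2 * k (mobius ζ v) ∂area := by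
  have himg : mobius ζ '' disc = disc := by
    refine Subset.antisymm (image_subset_iff.2 fun v hv => mobius_mem hζ hv) fun v hv => ?_
    exact ⟨mobius ζ v, mobius_mem hζ hv, mobius_mobius hζ hv⟩
  have hinj : InjOn (mobius ζ) disc := fun a ha b hb h => by
    rw [← mobius_mobius hζ ha, h, mobius_mobius hζ hb]
  have hder : ∀ v ∈ disc, HasFDerivWithinAt (mobius ζ)
      ((ContinuousLinearMap.toSpanSingleton ℂ (deriv (mobius ζ) v)).restrictScalars ℝ) disc v :=
    fun v hv => ((differentiableAt_mobius hζ hv).hasDerivAt.hasFDerivAt.restrictScalars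
      ℝ).hasFDerivWithinAt
  have key := lintegral_image_eq_lintegral_abs_det_fderiv_mul volume isOpen_disc.measurableSet
    hder hinj (fun w => ‖deriv f w‖ₑ ^ 2 * k w)
  rw [himg] at key
  rw [area, lintegral_smul_measure, lintegral_smul_measure, key]
  congr 1
  refine setLIntegral_congr_fun isOpen_disc.measurableSet fun v hv => ?_
  have hd : deriv (fun v => f (mobius ζ v)) v = deriv f (mobius ζ v) * deriv (mobius ζ) v :=
    deriv_comp (h₂ := f) (h := mobius ζ) v
      ((hf _ (mobius_mem hζ hv)).differentiableAt (isOpen_disc.mem_nhds (mobius_mem hζ hv)))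
      (differentiableAt_mobius hζ hv)
  rw [det_restrictScalars_toSpanSingleton, abs_of_nonneg (by positivity), ← enorm_sq_eq_ofReal, hd,
    enorm_mul, mul_pow]
  ring

/-- The point `w = ζ` must be excluded: there the kernel is `⊤`, while `Real.log 0 = 0` makes the
right side vanish. -/
theorem ofReal_mul_greenKernel {ζ w : ℂ} (hζ : ζ ∈ disc) (hw : w ≠ ζ) :
    ENNReal.ofReal (1 - ‖ζ‖ ^ 2) * greenKernel ζ w
      = ENNReal.ofReal (-Real.log (‖mobius ζ w‖ ^ 2)) := by
  have h := one_sub_norm_sq_pos hζ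
  rw [greenKernel, if_neg hw, ← ENNReal.ofReal_mul h.le, mul_div_cancel₀ _ h.ne', mobius,
    ← Real.log_inv, ← inv_pow, ← norm_inv, inv_div, norm_div, norm_div, norm_sub_rev w ζ]

theorem ae_area_ne (ζ : ℂ) : ∀ᵐ w ∂area, w ≠ ζ := by
  refine Measure.ae_smul_measure (ae_restrict_of_ae ?_) _
  exact Measure.ae_ne volume ζ

/-- The Littlewood–Paley identity based at a point of the disc. -/
theorem hardySq_comp_mobius {f : ℂ → ℂ} (hf : DifferentiableOn ℂ f disc) {ζ : ℂ}
    (hζ : ζ ∈ disc) :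
    hardySq (fun v => f (mobius ζ v)) = ‖f ζ‖ₑ ^ 2
      + ENNReal.ofReal (1 - ‖ζ‖ ^ 2) * ∫⁻ w, ‖deriv f w‖ₑ ^ 2 * greenKernel ζ w ∂area := by
  rw [hardySq_eq (differentiableOn_comp_mobius hf hζ), mobius_zero,
    ← lintegral_const_mul' _ _ ENNReal.ofReal_ne_top]
  congr 1
  have h1 : ∫⁻ w, ENNReal.ofReal (1 - ‖ζ‖ ^ 2) * (‖deriv f w‖ₑ ^ 2 * greenKernel ζ w) ∂area
      = ∫⁻ w, ‖deriv f w‖ₑ ^ 2 * ENNReal.ofReal (-Real.log (‖mobius ζ w‖ ^ 2)) ∂area := by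
    refine lintegral_congr_ae ?_
    filter_upwards [ae_area_ne ζ] with w hw
    rw [mul_left_comm, ofReal_mul_greenKernel hζ hw]
  -- The substitution by the involution turns `-log |φ_ζ|²` into the radial weight of `hardySq_eq`.
  rw [h1, lintegral_deriv_sq_comp_mobius hf hζ]
  refine lintegral_congr_ae ?_
  filter_upwards [ae_area_mem] with w hw
  rw [mobius_mobius hζ hw]

theorem circleMean_mobius_mul_le {K : ℂ → ℂ} {ζ : ℂ} (hζ : ζ ∈ disc) {r : ℝ}
    (hr : r ∈ Ioo (0 : ℝ) 1) : circleMean (fun v => mobius ζ v * K v) r ≤ circleMean K r := by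
  refine lintegral_mono fun θ => ?_
  simp only
  rw [enorm_mul, mul_pow]
  refine mul_le_of_le_one_left' (pow_le_one' ?_ 2)
  rw [← ofReal_norm, ENNReal.ofReal_le_one]
  exact (mem_disc.1 (mobius_mem hζ (polar_mem hr θ))).le

/-- Multiplication by an automorphism of the disc is isometric on `H²`. -/
theorem hardySq_mobius_mul {K : ℂ → ℂ} (hK : DifferentiableOn ℂ K disc) {ζ : ℂ}
    (hζ : ζ ∈ disc) : hardySq (fun v => mobius ζ v * K v) = hardySq K := by
  apply le_antisymm
  · exact iSup₂_mono fun r hr => circleMean_mobius_mul_le hζ hr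
  -- On the circle of radius `r` one has `1 - |φ_ζ|² ≤ C (1 - r²)`, so the factor `|φ_ζ|²` tends to
  -- `1` uniformly as `r → 1`.
  · set C : ℝ := (1 - ‖ζ‖ ^ 2) / (1 - ‖ζ‖) ^ 2 with hC
    have hζ1 : 0 < 1 - ‖ζ‖ := by linarith [mem_disc.1 hζ]
    have hlow : ∀ r ∈ Ioo (0 : ℝ) 1, ENNReal.ofReal (1 - C * (1 - r ^ 2)) * circleMean K r
        ≤ hardySq (fun v => mobius ζ v * K v) := by
      intro r hr
      refine le_trans ?_ (le_iSup₂ (f := fun r (_ : r ∈ Ioo (0 : ℝ) 1) =>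
        circleMean (fun v => mobius ζ v * K v) r) r hr)
      unfold circleMean
      rw [← lintegral_const_mul' _ _ ENNReal.ofReal_ne_top]
      refine lintegral_mono fun θ => ?_
      simp only
      rw [enorm_mul, mul_pow]
      gcongr
      rw [enorm_sq_eq_ofReal]
      refine ENNReal.ofReal_le_ofReal ?_
      have hv := polar_mem hr θ
      have h1 := one_sub_norm_mobius_sq hζ hv
      have h2 : (1 - ‖ζ‖) ^ 2 ≤ ‖1 - conj ζ * polar r θ‖ ^ 2 := by
        refine pow_le_pow_left₀ hζ1.le ?_ 2
        have h3 := norm_sub_norm_le 1 (conj ζ * polar r θ)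
        rw [norm_one, norm_mul, RCLike.norm_conj] at h3
        nlinarith [mem_disc.1 hv, norm_nonneg ζ]
      have h4 : ‖polar r θ‖ = r := by rw [norm_polar, abs_of_pos hr.1]
      have h5 := one_sub_norm_sq_pos hζ
      have h6 := one_sub_norm_sq_pos hv
      have h7 : (1 - ‖ζ‖ ^ 2) * (1 - ‖polar r θ‖ ^ 2) / ‖1 - conj ζ * polar r θ‖ ^ 2
          ≤ (1 - ‖ζ‖ ^ 2) * (1 - ‖polar r θ‖ ^ 2) / (1 - ‖ζ‖) ^ 2 := by
        gcongr
      rw [← h1] at h7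
      have h8 : C * (1 - r ^ 2) = (1 - ‖ζ‖ ^ 2) * (1 - ‖polar r θ‖ ^ 2) / (1 - ‖ζ‖) ^ 2 := by
        rw [hC, h4]; ring
      linarith
    have hlim : Tendsto (fun r : ℝ => ENNReal.ofReal (1 - C * (1 - r ^ 2)) * circleMean K r)
        (𝓝[<] 1) (𝓝 (1 * hardySq K)) := by
      refine ENNReal.Tendsto.mul ?_ (Or.inl one_ne_zero) (tendsto_circleMean hK) (Or.inr (by simp))
      have : Tendsto (fun r : ℝ => ENNReal.ofReal (1 - C * (1 - r ^ 2))) (𝓝 1)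
          (𝓝 (ENNReal.ofReal (1 - C * (1 - 1 ^ 2)))) :=
        ENNReal.tendsto_ofReal (Continuous.tendsto (by fun_prop) 1)
      simp only [one_pow, sub_self, mul_zero, sub_zero, ENNReal.ofReal_one] at this
      exact this.mono_left nhdsWithin_le_nhds
    rw [one_mul] at hlim
    refine le_of_tendsto hlim ?_
    filter_upwards [Ioo_mem_nhdsLT (zero_lt_one' ℝ)] with s hs
    exact hlow s hs

/-- Point evaluations on `H²`. -/
theorem enorm_sq_mul_le_hardySq {G : ℂ → ℂ} (hG : DifferentiableOn ℂ G disc) {a : ℂ}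
    (ha : a ∈ disc) : ‖G a‖ₑ ^ 2 * ENNReal.ofReal (1 - ‖a‖ ^ 2) ≤ hardySq G := by
  have h0 := one_sub_norm_sq_pos ha
  rw [enorm_sq_eq_ofReal, ← ENNReal.ofReal_mul (by positivity)]
  have hlim := ((hasSum_taylorCoeff hG a ha).tendsto_sum_nat.norm.pow 2).mul_const (1 - ‖a‖ ^ 2)
  refine le_of_tendsto' (ENNReal.tendsto_ofReal hlim) fun N => ?_
  rw [hardySq_taylor hG]
  refine le_trans ?_ (ENNReal.sum_le_tsum (Finset.range N))
  simp only [enorm_sq_eq_ofReal]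
  rw [← ENNReal.ofReal_sum_of_nonneg fun _ _ => by positivity]
  refine ENNReal.ofReal_le_ofReal ?_
  have h1 : ‖∑ n ∈ Finset.range N, taylorCoeff G n * a ^ n‖
      ≤ ∑ n ∈ Finset.range N, ‖taylorCoeff G n‖ * ‖a‖ ^ n := by
    refine (norm_sum_le _ _).trans (le_of_eq ?_)
    simp
  -- Cauchy–Schwarz against the geometric series, whose partial sums are at most `1 / (1 - |a|²)`.
  have h2 := Finset.sum_mul_sq_le_sq_mul_sq (Finset.range N) (fun n => ‖taylorCoeff G n‖)
    (fun n => ‖a‖ ^ n)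
  have h3 : (∑ n ∈ Finset.range N, (‖a‖ ^ n) ^ 2) * (1 - ‖a‖ ^ 2) ≤ 1 := by
    have h4 : ∀ n, (‖a‖ ^ n) ^ 2 = (‖a‖ ^ 2) ^ n := fun n => by rw [← pow_mul, ← pow_mul, mul_comm]
    simp only [h4]
    rw [geom_sum_mul_neg]
    have : 0 ≤ (‖a‖ ^ 2) ^ N := by positivity
    linarith
  calc _ ≤ (∑ n ∈ Finset.range N, ‖taylorCoeff G n‖ * ‖a‖ ^ n) ^ 2 * (1 - ‖a‖ ^ 2) := by gcongr
    _ ≤ ((∑ n ∈ Finset.range N, ‖taylorCoeff G n‖ ^ 2) * ∑ n ∈ Finset.range N, (‖a‖ ^ n) ^ 2)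
          * (1 - ‖a‖ ^ 2) := by gcongr
    _ = (∑ n ∈ Finset.range N, ‖taylorCoeff G n‖ ^ 2)
          * ((∑ n ∈ Finset.range N, (‖a‖ ^ n) ^ 2) * (1 - ‖a‖ ^ 2)) := by ring
    _ ≤ _ := mul_le_of_le_one_right (Finset.sum_nonneg fun _ _ => by positivity) h3

/-! ### Local Dirichlet integrals at points of the closed disc. -/

/-- The kernel whose integral against `μ` is the weight `U_μ`. -/
noncomputable def localKernel (ζ w : ℂ) : ℝ≥0∞ :=
  if ‖ζ‖ < 1 then greenKernel ζ w else poissonKernel ζ w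

/-- The local Dirichlet integral at a point of the closed disc. -/
noncomputable def localDirichlet (ζ : ℂ) (f : ℂ → ℂ) : ℝ≥0∞ :=
  ∫⁻ w, ‖deriv f w‖ₑ ^ 2 * localKernel ζ w ∂area

/-- A kernel comparable to `localKernel` without its logarithmic singularity. -/
noncomputable def smoothKernel (ζ w : ℂ) : ℝ≥0∞ :=
  ENNReal.ofReal ((1 - ‖w‖ ^ 2) / ‖1 - conj ζ * w‖ ^ 2)

/-- The Dirichlet integral for `smoothKernel`. -/
noncomputable def smoothDirichlet (ζ : ℂ) (f : ℂ → ℂ) : ℝ≥0∞ :=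
  ∫⁻ w, ‖deriv f w‖ₑ ^ 2 * smoothKernel ζ w ∂area

theorem localDirichlet_of_mem {ζ : ℂ} (hζ : ζ ∈ disc) (f : ℂ → ℂ) :
    localDirichlet ζ f = ∫⁻ w, ‖deriv f w‖ₑ ^ 2 * greenKernel ζ w ∂area := by
  simp [localDirichlet, localKernel, mem_disc.1 hζ]

/-- Since `smoothKernel` is comparable to the Green kernel inside the disc, it carries estimates
from the disc to the circle. -/
theorem smoothKernel_of_norm_eq_one {ζ : ℂ} (hζ : ‖ζ‖ = 1) (w : ℂ) :
    smoothKernel ζ w = poissonKernel ζ w := by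
  have := norm_sq_one_sub_conj_mul ζ w
  rw [hζ, one_pow, sub_self, zero_mul, add_zero] at this
  rw [smoothKernel, poissonKernel, this]

theorem localDirichlet_of_norm_eq_one {ζ : ℂ} (hζ : ‖ζ‖ = 1) (f : ℂ → ℂ) :
    localDirichlet ζ f = smoothDirichlet ζ f := by
  simp [localDirichlet, localKernel, smoothDirichlet, hζ, smoothKernel_of_norm_eq_one]

theorem ofReal_one_sub_norm_sq_ne_zero {ζ : ℂ} (hζ : ζ ∈ disc) :
    ENNReal.ofReal (1 - ‖ζ‖ ^ 2) ≠ 0 := by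
  rw [Ne, ENNReal.ofReal_eq_zero, not_le]
  exact one_sub_norm_sq_pos hζ

/-- Composition with `φ_ζ` turns multiplication by `w` into multiplication by `φ_ζ`, which is
isometric on `H²`. Equating `hardySq_comp_mobius` for `f` and `wf` leaves `|f(ζ)|² - |ζ f(ζ)|² = (1
- |ζ|²)|f(ζ)|²`. Only finite quantities are cancelled, so the Dirichlet integrals may be infinite.
-/
theorem localDirichlet_id_mul_of_mem {f : ℂ → ℂ} (hf : DifferentiableOn ℂ f disc) {ζ : ℂ}
    (hζ : ζ ∈ disc) :
    localDirichlet ζ (fun w => w * f w) = localDirichlet ζ f + ‖f ζ‖ₑ ^ 2 := by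
  have h1 := hardySq_comp_mobius hf hζ
  have h2 := hardySq_comp_mobius (f := fun w => w * f w) (differentiableOn_id.mul hf) hζ
  rw [hardySq_mobius_mul (differentiableOn_comp_mobius hf hζ) hζ, h1, ← localDirichlet_of_mem hζ,
    ← localDirichlet_of_mem hζ] at h2
  have h3 : ‖f ζ‖ₑ ^ 2 = ‖ζ * f ζ‖ₑ ^ 2 + ENNReal.ofReal (1 - ‖ζ‖ ^ 2) * ‖f ζ‖ₑ ^ 2 := by
    rw [enorm_mul, mul_pow, ← add_mul, enorm_sq_eq_ofReal ζ,
      ← ENNReal.ofReal_add (by positivity) (one_sub_norm_sq_pos hζ).le, add_sub_cancel,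
      ENNReal.ofReal_one, one_mul]
  nth_rewrite 1 [h3] at h2
  rw [add_assoc, ENNReal.add_right_inj (ENNReal.pow_ne_top enorm_ne_top), ← mul_add,
    ENNReal.mul_right_inj (ofReal_one_sub_norm_sq_ne_zero hζ) ENNReal.ofReal_ne_top] at h2
  rw [← h2, add_comm]

/-- Point evaluation is applied to `(f - f(ζ)) ∘ φ_ζ` at `ζ`, where `φ_ζ` is `0`; the factor `1 -
|ζ|²` then occurs on both sides and cancels. -/
theorem enorm_sq_le_localDirichlet {f : ℂ → ℂ} (hf : DifferentiableOn ℂ f disc) {ζ : ℂ}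
    (hζ : ζ ∈ disc) : ‖f ζ‖ₑ ^ 2 ≤ 2 * localDirichlet ζ f + 2 * ‖f 0‖ₑ ^ 2 := by
  have hg : DifferentiableOn ℂ (fun w => f w - f ζ) disc := hf.sub_const _
  have h1 := hardySq_comp_mobius hg hζ
  simp only [sub_self, enorm_zero, ne_eq, OfNat.ofNat_ne_zero, not_false_eq_true, zero_pow,
    zero_add, deriv_sub_const] at h1
  have h2 := enorm_sq_mul_le_hardySq (differentiableOn_comp_mobius hg hζ) hζ
  rw [h1, mobius_self, mul_comm, ← localDirichlet_of_mem hζ,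
    ENNReal.mul_le_mul_iff_right (ofReal_one_sub_norm_sq_ne_zero hζ) ENNReal.ofReal_ne_top] at h2
  have h3 := enorm_add_sq_le (-(f 0 - f ζ)) (f 0)
  rw [enorm_neg, show -(f 0 - f ζ) + f 0 = f ζ by ring] at h3
  exact h3.trans (by gcongr)

theorem ofReal_mul_smoothKernel {ζ w : ℂ} (hζ : ζ ∈ disc) (hw : w ∈ disc) :
    ENNReal.ofReal (1 - ‖ζ‖ ^ 2) * smoothKernel ζ w
      = ENNReal.ofReal (1 - ‖mobius ζ w‖ ^ 2) := by
  rw [smoothKernel, ← ENNReal.ofReal_mul (one_sub_norm_sq_pos hζ).le,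
    one_sub_norm_mobius_sq hζ hw, mul_div_assoc]

theorem mobius_ne_zero {ζ w : ℂ} (hζ : ζ ∈ disc) (hw : w ∈ disc) (h : w ≠ ζ) :
    mobius ζ w ≠ 0 :=
  div_ne_zero (sub_ne_zero.2 h.symm) (one_sub_conj_mul_ne_zero (mem_disc.1 hζ).le hw)

/-- Pointwise, from `1 - x ≤ -log x` with `x = |φ_ζ(w)|²`. -/
theorem smoothDirichlet_le_localDirichlet (f : ℂ → ℂ) {ζ : ℂ} (hζ : ζ ∈ disc) :
    smoothDirichlet ζ f ≤ localDirichlet ζ f := by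
  rw [localDirichlet_of_mem hζ]
  refine lintegral_mono_ae ?_
  filter_upwards [ae_area_mem, ae_area_ne ζ] with w hw hne
  gcongr
  rw [← ENNReal.mul_le_mul_iff_right (ofReal_one_sub_norm_sq_ne_zero hζ) ENNReal.ofReal_ne_top,
    ofReal_mul_smoothKernel hζ hw, ofReal_mul_greenKernel hζ hne]
  refine ENNReal.ofReal_le_ofReal ?_
  have := norm_pos_iff.2 (mobius_ne_zero hζ hw hne)
  linarith [Real.log_le_sub_one_of_pos (show 0 < ‖mobius ζ w‖ ^ 2 by positivity)]

/-- The logarithmic singularity rules out a pointwise bound; conformal invariance reduces to the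
base point `0`, where `lintegral_deriv_sq_mul_log_le` applies. -/
theorem localDirichlet_le_smoothDirichlet {f : ℂ → ℂ} (hf : DifferentiableOn ℂ f disc) {ζ : ℂ}
    (hζ : ζ ∈ disc) : localDirichlet ζ f ≤ 2 * smoothDirichlet ζ f := by
  rw [← ENNReal.mul_le_mul_iff_right (ofReal_one_sub_norm_sq_ne_zero hζ) ENNReal.ofReal_ne_top,
    localDirichlet_of_mem hζ, mul_left_comm, smoothDirichlet,
    ← lintegral_const_mul' _ _ ENNReal.ofReal_ne_top,
    ← lintegral_const_mul' _ _ ENNReal.ofReal_ne_top]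
  have h1 : ∫⁻ w, ENNReal.ofReal (1 - ‖ζ‖ ^ 2) * (‖deriv f w‖ₑ ^ 2 * greenKernel ζ w) ∂area
      = ∫⁻ w, ‖deriv f w‖ₑ ^ 2 * ENNReal.ofReal (-Real.log (‖mobius ζ w‖ ^ 2)) ∂area := by
    refine lintegral_congr_ae ?_
    filter_upwards [ae_area_ne ζ] with w hw
    rw [mul_left_comm, ofReal_mul_greenKernel hζ hw]
  have h2 : ∫⁻ w, ENNReal.ofReal (1 - ‖ζ‖ ^ 2) * (‖deriv f w‖ₑ ^ 2 * smoothKernel ζ w) ∂area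
      = ∫⁻ w, ‖deriv f w‖ₑ ^ 2 * ENNReal.ofReal (1 - ‖mobius ζ w‖ ^ 2) ∂area := by
    refine lintegral_congr_ae ?_
    filter_upwards [ae_area_mem] with w hw
    rw [mul_left_comm, ofReal_mul_smoothKernel hζ hw]
  rw [h1, h2, lintegral_deriv_sq_comp_mobius hf hζ, lintegral_deriv_sq_comp_mobius hf hζ]
  refine le_trans (le_of_eq ?_) ((lintegral_deriv_sq_mul_log_le
    (differentiableOn_comp_mobius hf hζ)).trans (le_of_eq ?_))
  · refine lintegral_congr_ae ?_
    filter_upwards [ae_area_mem] with w hw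
    rw [mobius_mobius hζ hw]
  · congr 1
    refine lintegral_congr_ae ?_
    filter_upwards [ae_area_mem] with w hw
    rw [mobius_mobius hζ hw]

theorem ofReal_mul_mem_disc {ζ : ℂ} (hζ : ‖ζ‖ = 1) {ρ : ℝ} (hρ : ρ ∈ Ioo (0 : ℝ) 1) :
    (ρ : ℂ) * ζ ∈ disc := by
  rw [mem_disc, norm_mul, hζ, mul_one, Complex.norm_real, Real.norm_of_nonneg hρ.1.le]
  exact hρ.2

/-- Here `|1 - conj ζ w| ≤ |1 - ρ conj ζ w| + (1 - ρ) ≤ 2 |1 - ρ conj ζ w|`; squaring gives `4`. -/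
theorem smoothKernel_radial_le {ζ w : ℂ} (hζ : ‖ζ‖ = 1) (hw : w ∈ disc) {ρ : ℝ}
    (hρ : ρ ∈ Ioo (0 : ℝ) 1) : smoothKernel (ρ * ζ) w ≤ 4 * smoothKernel ζ w := by
  have hw1 := one_sub_norm_sq_pos hw
  have h1 := norm_pos_iff.2 (one_sub_conj_mul_ne_zero hζ.le hw)
  have h2 := norm_pos_iff.2
    (one_sub_conj_mul_ne_zero (mem_disc.1 (ofReal_mul_mem_disc hζ hρ)).le hw)
  have hn : ‖conj ζ * w‖ ≤ 1 := by
    rw [norm_mul, RCLike.norm_conj, hζ, one_mul]; exact (mem_disc.1 hw).le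
  have h3 : ‖1 - conj ζ * w‖ ≤ 2 * ‖1 - conj ((ρ : ℂ) * ζ) * w‖ := by
    have e1 : 1 - conj ζ * w
        = (1 - conj ((ρ : ℂ) * ζ) * w) - ((1 - ρ : ℝ) : ℂ) * (conj ζ * w) := by
      rw [map_mul, Complex.conj_ofReal]; push_cast; ring
    have e2 : ‖((1 - ρ : ℝ) : ℂ) * (conj ζ * w)‖ ≤ 1 - ρ := by
      rw [norm_mul, Complex.norm_real, Real.norm_of_nonneg (by linarith [hρ.2])]
      nlinarith [hρ.2]
    have e3 : 1 - ρ ≤ ‖1 - conj ((ρ : ℂ) * ζ) * w‖ := by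
      have e4 := norm_sub_norm_le 1 (conj ((ρ : ℂ) * ζ) * w)
      rw [map_mul, Complex.conj_ofReal, mul_assoc, norm_one, norm_mul, Complex.norm_real,
        Real.norm_of_nonneg hρ.1.le] at e4
      rw [map_mul, Complex.conj_ofReal, mul_assoc]
      nlinarith [hρ.1]
    have e5 := norm_sub_le (1 - conj ((ρ : ℂ) * ζ) * w) (((1 - ρ : ℝ) : ℂ) * (conj ζ * w))
    rw [← e1] at e5
    linarith
  rw [smoothKernel, smoothKernel, ← ENNReal.ofReal_ofNat, ← ENNReal.ofReal_mul (by norm_num)]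
  refine ENNReal.ofReal_le_ofReal ?_
  rw [← mul_div_assoc, div_le_div_iff₀ (by positivity) (by positivity)]
  have : ‖1 - conj ζ * w‖ ^ 2 ≤ 4 * ‖1 - conj ((ρ : ℂ) * ζ) * w‖ ^ 2 := by nlinarith
  nlinarith

theorem smoothDirichlet_radial_le (f : ℂ → ℂ) {ζ : ℂ} (hζ : ‖ζ‖ = 1) {ρ : ℝ}
    (hρ : ρ ∈ Ioo (0 : ℝ) 1) : smoothDirichlet (ρ * ζ) f ≤ 4 * smoothDirichlet ζ f := by
  rw [smoothDirichlet, smoothDirichlet, ← lintegral_const_mul' _ _ (by simp)]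
  refine lintegral_mono_ae ?_
  filter_upwards [ae_area_mem] with w hw
  rw [mul_left_comm]
  gcongr
  exact smoothKernel_radial_le hζ hw hρ

/-- A sequence in `(0, 1)` tending to `1`. -/
noncomputable def radius (n : ℕ) : ℝ := 1 - 1 / ((n : ℝ) + 2)

theorem radius_mem (n : ℕ) : radius n ∈ Ioo (0 : ℝ) 1 := by
  have hn : (0 : ℝ) ≤ n := n.cast_nonneg
  have h1 : 1 / ((n : ℝ) + 2) < 1 := by rw [div_lt_one (by positivity)]; linarith
  have h2 : 0 < 1 / ((n : ℝ) + 2) := by positivity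
  unfold radius
  exact ⟨by linarith, by linarith⟩

theorem tendsto_radius : Tendsto radius atTop (𝓝 1) := by
  have h : Tendsto (fun n : ℕ => 1 / ((n : ℝ) + 2)) atTop (𝓝 0) := by
    have := (tendsto_one_div_add_atTop_nhds_zero_nat (𝕜 := ℝ)).comp (tendsto_add_atTop_nat 1)
    refine this.congr fun n => ?_
    simp only [Function.comp_apply]; push_cast; ring
  have h1 := h.const_sub 1
  rw [sub_zero] at h1
  exact h1

theorem tendsto_radius_mul (ζ : ℂ) : Tendsto (fun n => (radius n : ℂ) * ζ) atTop (𝓝 ζ) := by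
  have : Tendsto (fun n => (radius n : ℂ)) atTop (𝓝 ((1 : ℝ) : ℂ)) :=
    (Complex.continuous_ofReal.tendsto 1).comp tendsto_radius
  simpa using this.mul_const ζ

theorem measurable_smoothKernel (ζ : ℂ) : Measurable (smoothKernel ζ) := by
  unfold smoothKernel; fun_prop

/-- Fatou's lemma along a sequence of radii tending to `1`. -/
theorem smoothDirichlet_le_of_forall {f : ℂ → ℂ} {ζ : ℂ} (hζ : ‖ζ‖ = 1) {B : ℝ≥0∞}
    (hB : ∀ ρ ∈ Ioo (0 : ℝ) 1, smoothDirichlet (ρ * ζ) f ≤ B) : smoothDirichlet ζ f ≤ B := by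
  have hm : ∀ n : ℕ, Measurable fun w => ‖deriv f w‖ₑ ^ 2 * smoothKernel (radius n * ζ) w :=
    fun n => ((measurable_deriv f).enorm.pow_const 2).mul (measurable_smoothKernel _)
  have h1 : smoothDirichlet ζ f = ∫⁻ w, liminf (fun n =>
      ‖deriv f w‖ₑ ^ 2 * smoothKernel (radius n * ζ) w) atTop ∂area := by
    refine lintegral_congr_ae ?_
    filter_upwards [ae_area_mem] with w hw
    refine (Tendsto.liminf_eq (ENNReal.Tendsto.const_mul ?_ (Or.inr (by simp)))).symm
    refine ENNReal.tendsto_ofReal (Tendsto.div tendsto_const_nhds ?_ ?_)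
    · refine ((tendsto_const_nhds.sub (Tendsto.mul_const _ ?_)).norm).pow 2
      exact (Complex.continuous_conj.tendsto ζ).comp (tendsto_radius_mul ζ)
    · exact pow_ne_zero _ (norm_ne_zero_iff.2 (one_sub_conj_mul_ne_zero hζ.le hw))
  rw [h1]
  refine (lintegral_liminf_le hm).trans (liminf_le_of_le (by isBoundedDefault) fun b hb => ?_)
  obtain ⟨n, hn⟩ := hb.exists
  exact hn.trans (hB _ (radius_mem n))

/-- Multiplication by the coordinate function is bounded for local Dirichlet integrals. -/
theorem localDirichlet_id_mul_le {f : ℂ → ℂ} (hf : DifferentiableOn ℂ f disc) {ζ : ℂ}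
    (hζ : ‖ζ‖ ≤ 1) :
    localDirichlet ζ (fun w => w * f w) ≤ 24 * localDirichlet ζ f + 2 * ‖f 0‖ₑ ^ 2 := by
  have key : ∀ ζ ∈ disc,
      localDirichlet ζ (fun w => w * f w) ≤ 3 * localDirichlet ζ f + 2 * ‖f 0‖ₑ ^ 2 := by
    intro ζ hζ
    rw [localDirichlet_id_mul_of_mem hf hζ]
    calc _ ≤ localDirichlet ζ f + (2 * localDirichlet ζ f + 2 * ‖f 0‖ₑ ^ 2) := by
          gcongr; exact enorm_sq_le_localDirichlet hf hζ
      _ = _ := by ring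
  rcases hζ.lt_or_eq with h | h
  · refine (key ζ (mem_disc.2 h)).trans ?_
    gcongr
    norm_num
  · rw [localDirichlet_of_norm_eq_one h, localDirichlet_of_norm_eq_one h]
    refine smoothDirichlet_le_of_forall h fun ρ hρ => ?_
    have hm := ofReal_mul_mem_disc h hρ
    calc _ ≤ _ := smoothDirichlet_le_localDirichlet _ hm
      _ ≤ _ := key _ hm
      -- The constant `24` is `3` from the disc, `2` from the comparison of kernels and `4` from the
      -- radial move.
      _ ≤ 3 * (2 * (4 * smoothDirichlet ζ f)) + 2 * ‖f 0‖ₑ ^ 2 := by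
        gcongr
        refine (localDirichlet_le_smoothDirichlet hf hm).trans ?_
        gcongr
        exact smoothDirichlet_radial_le f h hρ
      _ = _ := by ring

/-- Division by the coordinate function is bounded for local Dirichlet integrals. -/
theorem localDirichlet_le_id_mul {f : ℂ → ℂ} (hf : DifferentiableOn ℂ f disc) {ζ : ℂ}
    (hζ : ‖ζ‖ ≤ 1) : localDirichlet ζ f ≤ 8 * localDirichlet ζ (fun w => w * f w) := by
  have key : ∀ ζ ∈ disc, localDirichlet ζ f ≤ localDirichlet ζ (fun w => w * f w) := by
    intro ζ hζ
    rw [localDirichlet_id_mul_of_mem hf hζ]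
    exact le_self_add
  rcases hζ.lt_or_eq with h | h
  · exact (key ζ (mem_disc.2 h)).trans (le_mul_of_one_le_left' (by norm_num))
  · rw [localDirichlet_of_norm_eq_one h, localDirichlet_of_norm_eq_one h]
    refine smoothDirichlet_le_of_forall h fun ρ hρ => ?_
    have hm := ofReal_mul_mem_disc h hρ
    calc _ ≤ _ := smoothDirichlet_le_localDirichlet _ hm
      _ ≤ _ := key _ hm
      _ ≤ 2 * (4 * smoothDirichlet ζ (fun w => w * f w)) := by
        refine (localDirichlet_le_smoothDirichlet (f := fun w => w * f w)
          (differentiableOn_id.mul hf) hm).trans ?_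
        gcongr
        exact smoothDirichlet_radial_le _ h hρ
      _ = _ := by ring

/-! ### Unit mass of the kernels and radial limits at the circle. -/

instance : IsProbabilityMeasure area := ⟨by
  have h : ENNReal.ofReal Real.pi ≠ 0 := by simp [Real.pi_pos]
  have hv : volume disc = ENNReal.ofReal Real.pi := by
    rw [disc, Complex.volume_ball, ENNReal.ofReal_one, one_pow, one_mul,
      ENNReal.ofReal, ← NNReal.coe_real_pi, Real.toNNReal_coe]
  simp only [area, Measure.smul_apply, Measure.restrict_apply_univ, smul_eq_mul, hv]
  exact ENNReal.inv_mul_cancel h ENNReal.ofReal_ne_top⟩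

theorem lintegral_two_mul : ∫⁻ r in Ioo (0 : ℝ) 1, ENNReal.ofReal (2 * r) = 1 := by
  rw [setLIntegral_ofReal_eq_sub (G := fun r => r ^ 2) (by fun_prop)]
  · simp
  · intro x _
    simpa using hasDerivAt_pow 2 x
  · intro x hx
    linarith [hx.1]

/-- The geometric series `1 / (1 - conj ζ w)` has unimodular coefficients, hence mean square `1 / (1
- r²)`, which cancels the numerator of the kernel. -/
theorem lintegral_smoothKernel {ζ : ℂ} (hζ : ‖ζ‖ = 1) : ∫⁻ w, smoothKernel ζ w ∂area = 1 := by
  rw [lintegral_area_polar (measurable_smoothKernel ζ), ← lintegral_two_mul]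
  refine setLIntegral_congr_fun measurableSet_Ioo fun r hr => ?_
  have hsum : ∀ w ∈ disc,
      HasSum (fun n => (conj ζ) ^ n * w ^ n) ((fun w => (1 - conj ζ * w)⁻¹) w) := fun w hw => by
    simp only [← mul_pow]
    refine hasSum_geometric_of_norm_lt_one ?_
    rw [norm_mul, RCLike.norm_conj, hζ, one_mul]
    exact mem_disc.1 hw
  have h1 := circleMean_eq_tsum hsum hr
  have h2 : ∫⁻ θ, smoothKernel ζ (polar r θ) ∂angle
      = ENNReal.ofReal (1 - r ^ 2) * circleMean (fun w => (1 - conj ζ * w)⁻¹) r := by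
    unfold circleMean
    rw [← lintegral_const_mul' _ _ ENNReal.ofReal_ne_top]
    refine lintegral_congr fun θ => ?_
    rw [smoothKernel, norm_polar, sq_abs, enorm_sq_eq_ofReal, ← ENNReal.ofReal_mul
      (by nlinarith [hr.1, hr.2]), norm_inv, inv_pow, div_eq_mul_inv]
  have h3 : r ^ 2 < 1 := by nlinarith [hr.1, hr.2]
  have h4 : ∀ n : ℕ, ‖(conj ζ) ^ n‖ₑ ^ 2 * ENNReal.ofReal (r ^ (2 * n))
      = ENNReal.ofReal ((r ^ 2) ^ n) := fun n => by
    rw [enorm_sq_eq_ofReal, norm_pow, RCLike.norm_conj, hζ, pow_mul]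
    simp
  simp only [h2, h1, h4]
  rw [← ENNReal.ofReal_tsum_of_nonneg (fun n => by positivity)
    (summable_geometric_of_lt_one (by positivity) h3),
    tsum_geometric_of_lt_one (by positivity) h3, ← ENNReal.ofReal_mul (by linarith),
    mul_inv_cancel₀ (by linarith), ENNReal.ofReal_one, mul_one]

/-- The local formula for `f = 1`: the mass is the local Dirichlet integral of the coordinate. -/
theorem lintegral_greenKernel {ζ : ℂ} (hζ : ζ ∈ disc) : ∫⁻ w, greenKernel ζ w ∂area = 1 := by
  have h := localDirichlet_id_mul_of_mem (f := fun _ => 1) (differentiableOn_const 1) hζ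
  rw [localDirichlet_of_mem hζ, localDirichlet_of_mem hζ] at h
  simpa using h

/-- With `x = |φ_{ρζ}(w)|² → 1`, `-log x` is asymptotic to `1 - x`, and `(1 - x) / (1 - |ρζ|²)` is
exactly `smoothKernel (ρζ) w`. -/
theorem tendsto_greenKernel {ζ w : ℂ} (hζ : ‖ζ‖ = 1) (hw : w ∈ disc) :
    Tendsto (fun n => greenKernel (radius n * ζ) w) atTop (𝓝 (smoothKernel ζ w)) := by
  have hm := fun n => ofReal_mul_mem_disc hζ (radius_mem n)
  have ht := tendsto_radius_mul ζ
  have hne : ∀ᶠ n in atTop, w ≠ radius n * ζ := by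
    have hwζ : ζ ≠ w := by
      rintro rfl
      exact absurd (mem_disc.1 hw) (by rw [hζ]; exact lt_irrefl 1)
    filter_upwards [ht.eventually_ne hwζ] with n hn using hn.symm
  have hden : Tendsto (fun n => ‖1 - conj ((radius n : ℂ) * ζ) * w‖ ^ 2) atTop
      (𝓝 (‖1 - conj ζ * w‖ ^ 2)) :=
    ((tendsto_const_nhds.sub (Tendsto.mul_const _
      ((Complex.continuous_conj.tendsto ζ).comp ht))).norm).pow 2
  have hden0 : ‖1 - conj ζ * w‖ ^ 2 ≠ 0 :=
    pow_ne_zero _ (norm_ne_zero_iff.2 (one_sub_conj_mul_ne_zero hζ.le hw))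
  set x : ℕ → ℝ := fun n => ‖mobius (radius n * ζ) w‖ ^ 2 with hx
  have hx1 : ∀ n, 1 - x n = (1 - ‖(radius n : ℂ) * ζ‖ ^ 2) * (1 - ‖w‖ ^ 2)
      / ‖1 - conj ((radius n : ℂ) * ζ) * w‖ ^ 2 := fun n => one_sub_norm_mobius_sq (hm n) hw
  have hxpos : ∀ n, 0 < 1 - x n := fun n => one_sub_norm_sq_pos (mobius_mem (hm n) hw)
  have hxlim : Tendsto x atTop (𝓝 1) := by
    have h1 : Tendsto (fun n => 1 - x n) atTop (𝓝 ((1 - ‖ζ‖ ^ 2) * (1 - ‖w‖ ^ 2)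
        / ‖1 - conj ζ * w‖ ^ 2)) := by
      simp only [hx1]
      exact Tendsto.div ((tendsto_const_nhds.sub (ht.norm.pow 2)).mul_const _) hden hden0
    rw [hζ, one_pow, sub_self, zero_mul, zero_div] at h1
    simpa using h1.const_sub 1
  have hslope : Tendsto (fun n => Real.log (x n) / (x n - 1)) atTop (𝓝 1) := by
    have h1 := hasDerivAt_iff_tendsto_slope.1 (Real.hasDerivAt_log one_ne_zero)
    have h2 := h1.comp (tendsto_nhdsWithin_iff.2 ⟨hxlim, Eventually.of_forall fun n => by
      have := hxpos n
      simp only [mem_compl_iff, mem_singleton_iff]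
      linarith⟩)
    rw [inv_one] at h2
    refine h2.congr fun n => ?_
    simp [slope_def_field]
  have hlim : Tendsto (fun n => ENNReal.ofReal (Real.log (x n) / (x n - 1) *
      ((1 - ‖w‖ ^ 2) / ‖1 - conj ((radius n : ℂ) * ζ) * w‖ ^ 2))) atTop
      (𝓝 (smoothKernel ζ w)) := by
    have := hslope.mul (Tendsto.div (tendsto_const_nhds (x := 1 - ‖w‖ ^ 2)) hden hden0)
    rw [one_mul] at this
    exact ENNReal.tendsto_ofReal this
  refine hlim.congr' ?_
  filter_upwards [hne] with n hn
  have ha := one_sub_norm_sq_pos (hm n)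
  rw [← ENNReal.mul_right_inj (ofReal_one_sub_norm_sq_ne_zero (hm n)) ENNReal.ofReal_ne_top,
    ofReal_mul_greenKernel (hm n) hn, ← ENNReal.ofReal_mul ha.le]
  congr 1
  have h1 := hx1 n
  have h2 := hxpos n
  have h3 : x n - 1 ≠ 0 := by linarith
  rw [mul_left_comm, ← mul_div_assoc, ← h1]
  change _ = -Real.log (x n)
  field_simp
  ring

theorem measurable_greenKernel (ζ : ℂ) : Measurable (greenKernel ζ) := by
  classical
  unfold greenKernel
  refine Measurable.ite (measurableSet_eq_fun measurable_id measurable_const) measurable_const ?_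
  fun_prop

/-- Convergence of integrals of a bounded function against densities of constant mass that
converge almost everywhere. -/
theorem tendsto_lintegral_mul_of_mass {α : Type*} [MeasurableSpace α] {m : Measure α}
    {g P : α → ℝ≥0∞} {G : ℕ → α → ℝ≥0∞} {M : ℝ≥0∞} (hM : M ≠ ⊤) (hg : Measurable g)
    (hgM : ∀ᵐ w ∂m, g w ≤ M) (hG : ∀ n, Measurable (G n)) (hP : Measurable P)
    (hGm : ∀ n, ∫⁻ w, G n w ∂m = 1) (hPm : ∫⁻ w, P w ∂m = 1)
    (hlim : ∀ᵐ w ∂m, Tendsto (fun n => G n w) atTop (𝓝 (P w))) :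
    Tendsto (fun n => ∫⁻ w, g w * G n w ∂m) atTop (𝓝 (∫⁻ w, g w * P w ∂m)) := by
  -- Fatou for `g` bounds the liminf from below. Fatou for `M - g` bounds the limsup from above,
  -- because the two integrals always add up to `M`.
  have fatou : ∀ k : α → ℝ≥0∞, Measurable k → (∀ᵐ w ∂m, k w ≠ ⊤) →
      ∫⁻ w, k w * P w ∂m ≤ liminf (fun n => ∫⁻ w, k w * G n w ∂m) atTop := by
    intro k hk hkt
    refine le_trans (le_of_eq ?_) (lintegral_liminf_le fun n => hk.mul (hG n))
    refine lintegral_congr_ae ?_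
    filter_upwards [hlim, hkt] with w hw hkw
    exact (ENNReal.Tendsto.const_mul hw (Or.inr hkw)).liminf_eq.symm
  have hsplit : ∀ Q : α → ℝ≥0∞, Measurable Q → ∫⁻ w, Q w ∂m = 1 →
      (∫⁻ w, g w * Q w ∂m) + ∫⁻ w, (M - g w) * Q w ∂m = M := by
    intro Q hQ hQm
    have hgQ : Measurable fun w => g w * Q w := hg.mul hQ
    rw [← lintegral_add_left hgQ]
    have : ∫⁻ w, g w * Q w + (M - g w) * Q w ∂m = ∫⁻ w, M * Q w ∂m := by
      refine lintegral_congr_ae ?_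
      filter_upwards [hgM] with w hw
      rw [← add_mul, add_tsub_cancel_of_le hw]
    rw [this, lintegral_const_mul _ hQ, hQm, mul_one]
  have hfin : ∀ Q : α → ℝ≥0∞, Measurable Q → ∫⁻ w, Q w ∂m = 1 →
      ∫⁻ w, (M - g w) * Q w ∂m ≠ ⊤ := fun Q hQ hQm =>
    ne_top_of_le_ne_top hM (le_of_le_of_eq le_add_self (hsplit Q hQ hQm))
  have heq : ∀ Q : α → ℝ≥0∞, Measurable Q → ∫⁻ w, Q w ∂m = 1 →
      ∫⁻ w, g w * Q w ∂m = M - ∫⁻ w, (M - g w) * Q w ∂m := fun Q hQ hQm =>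
    ENNReal.eq_sub_of_add_eq (hfin Q hQ hQm) (hsplit Q hQ hQm)
  refine tendsto_of_le_liminf_of_limsup_le (fatou g hg ?_) ?_
  · filter_upwards [hgM] with w hw using ne_top_of_le_ne_top hM hw
  · have h1 : (fun n => ∫⁻ w, g w * G n w ∂m) = fun n => M - ∫⁻ w, (M - g w) * G n w ∂m :=
      funext fun n => heq _ (hG n) (hGm n)
    rw [h1, heq P hP hPm, ENNReal.limsup_const_sub _ _ hM]
    refine tsub_le_tsub_left (fatou _ (hg.const_sub M) ?_) M
    exact Eventually.of_forall fun w => ne_top_of_le_ne_top hM tsub_le_self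

theorem tendsto_localDirichlet_radius {f : ℂ → ℂ} {M : ℝ} (hM : ∀ w ∈ disc, ‖deriv f w‖ ≤ M)
    {ζ : ℂ} (hζ : ‖ζ‖ = 1) :
    Tendsto (fun n => localDirichlet (radius n * ζ) f) atTop (𝓝 (localDirichlet ζ f)) := by
  have hm := fun n => ofReal_mul_mem_disc hζ (radius_mem n)
  have := tendsto_lintegral_mul_of_mass (m := area) (g := fun w => ‖deriv f w‖ₑ ^ 2)
    (M := ENNReal.ofReal (M ^ 2)) ENNReal.ofReal_ne_top ((measurable_deriv f).enorm.pow_const 2)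
    (by
      filter_upwards [ae_area_mem] with w hw
      rw [enorm_sq_eq_ofReal]
      exact ENNReal.ofReal_le_ofReal (pow_le_pow_left₀ (norm_nonneg _) (hM w hw) 2))
    (fun n => measurable_greenKernel _) (measurable_smoothKernel ζ)
    (fun n => lintegral_greenKernel (hm n)) (lintegral_smoothKernel hζ)
    (by filter_upwards [ae_area_mem] with w hw using tendsto_greenKernel hζ hw)
  rw [localDirichlet_of_norm_eq_one hζ]
  exact this.congr fun n => (localDirichlet_of_mem (hm n) f).symm

theorem exists_norm_deriv_polynomial_le (p : Polynomial ℂ) :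
    ∃ M : ℝ, ∀ w ∈ disc, ‖deriv (fun z => p.eval z) w‖ ≤ M := by
  obtain ⟨M, hM⟩ := (isCompact_closedBall (0 : ℂ) 1).exists_bound_of_continuousOn
    (f := fun z => p.derivative.eval z) (by fun_prop)
  refine ⟨M, fun w hw => ?_⟩
  rw [Polynomial.deriv]
  exact hM w (Metric.ball_subset_closedBall hw)

/-- At the circle both Dirichlet integrals are radial limits, since the derivatives are bounded, and
`p` is continuous up to the boundary. -/
theorem localDirichlet_id_mul_polynomial (p : Polynomial ℂ) {ζ : ℂ} (hζ : ‖ζ‖ ≤ 1) :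
    localDirichlet ζ (fun w => w * p.eval w)
      = localDirichlet ζ (fun w => p.eval w) + ‖p.eval ζ‖ₑ ^ 2 := by
  have hd : DifferentiableOn ℂ (fun w => p.eval w) disc := p.differentiable.differentiableOn
  rcases hζ.lt_or_eq with h | h
  · exact localDirichlet_id_mul_of_mem hd (mem_disc.2 h)
  · obtain ⟨M, hM⟩ := exists_norm_deriv_polynomial_le p
    obtain ⟨M', hM'⟩ := exists_norm_deriv_polynomial_le (Polynomial.X * p)
    simp only [Polynomial.eval_mul, Polynomial.eval_X] at hM'
    have h1 := tendsto_localDirichlet_radius hM' h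
    have h2 := tendsto_localDirichlet_radius hM h
    have h3 : Tendsto (fun n => ‖p.eval ((radius n : ℂ) * ζ)‖ₑ ^ 2) atTop
        (𝓝 (‖p.eval ζ‖ₑ ^ 2)) :=
      ((ENNReal.continuous_pow 2).tendsto _).comp
        (((p.continuous.tendsto ζ).comp (tendsto_radius_mul ζ)).enorm)
    refine tendsto_nhds_unique h1 ((h2.add h3).congr fun n => ?_)
    exact (localDirichlet_id_mul_of_mem hd (ofReal_mul_mem_disc h (radius_mem n))).symm

/-! ### Weighted Dirichlet integrals as superpositions of local ones. -/

theorem lintegral_localKernel {ζ : ℂ} (hζ : ‖ζ‖ ≤ 1) : ∫⁻ w, localKernel ζ w ∂area = 1 := by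
  rcases hζ.lt_or_eq with h | h
  · simp [localKernel, h, lintegral_greenKernel (mem_disc.2 h)]
  · simp [localKernel, h, ← smoothKernel_of_norm_eq_one h, lintegral_smoothKernel h]

theorem measurable_localKernel : Measurable fun p : ℂ × ClosedDisc => localKernel (p.2 : ℂ) p.1 := by
  classical
  unfold localKernel
  have h1 : Measurable fun p : ℂ × ClosedDisc => greenKernel (p.2 : ℂ) p.1 := by
    unfold greenKernel
    refine Measurable.ite (measurableSet_eq_fun measurable_fst (by fun_prop))
      measurable_const ?_
    refine ENNReal.measurable_ofReal.comp (Measurable.div (Real.measurable_log.comp ?_) ?_)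
    · refine (Measurable.norm (Measurable.div (measurable_const.sub
        (Measurable.mul ?_ measurable_fst)) (by fun_prop))).pow_const 2
      exact Complex.continuous_conj.measurable.comp (by fun_prop)
    · fun_prop
  refine Measurable.ite (measurableSet_lt (by fun_prop) measurable_const) h1 ?_
  unfold poissonKernel
  fun_prop

theorem norm_closedDisc_le (ζ : ClosedDisc) : ‖(ζ : ℂ)‖ ≤ 1 :=
  mem_closedBall_zero_iff.1 ζ.2

theorem weight_eq (μ : Measure ClosedDisc) (w : ℂ) :
    weight μ w = ∫⁻ ζ : ClosedDisc, localKernel ζ w ∂μ := by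
  have hm : MeasurableSet {ζ : ClosedDisc | ‖(ζ : ℂ)‖ < 1} :=
    measurableSet_lt (by fun_prop) measurable_const
  have hm' : MeasurableSet {ζ : ClosedDisc | ‖(ζ : ℂ)‖ = 1} :=
    measurableSet_eq_fun (by fun_prop) measurable_const
  have hc : {ζ : ClosedDisc | ‖(ζ : ℂ)‖ < 1}ᶜ = {ζ : ClosedDisc | ‖(ζ : ℂ)‖ = 1} := by
    ext ζ
    simp only [mem_compl_iff, mem_ofPred_eq, not_lt]
    exact ⟨fun h => le_antisymm (norm_closedDisc_le ζ) h, fun h => h.ge⟩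
  rw [← lintegral_add_compl _ hm, hc, weight]
  congr 1
  · refine setLIntegral_congr_fun hm fun ζ hζ => ?_
    simp only [localKernel]
    rw [if_pos (by simpa only [mem_ofPred_eq] using hζ)]
  · refine setLIntegral_congr_fun hm' fun ζ hζ => ?_
    simp only [localKernel]
    have h1 : ‖(ζ : ℂ)‖ = 1 := by simpa only [mem_ofPred_eq] using hζ
    rw [if_neg h1.ge.not_gt]

/-- The weighted Dirichlet integral is the superposition of the local ones. -/
theorem lintegral_weight (μ : Measure ClosedDisc) [IsFiniteMeasure μ] (f : ℂ → ℂ) :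
    ∫⁻ w, ‖deriv f w‖ₑ ^ 2 * weight μ w ∂area = ∫⁻ ζ : ClosedDisc, localDirichlet ζ f ∂μ := by
  have h1 : ∀ w, ‖deriv f w‖ₑ ^ 2 * weight μ w
      = ∫⁻ ζ : ClosedDisc, ‖deriv f w‖ₑ ^ 2 * localKernel ζ w ∂μ := fun w => by
    rw [weight_eq, lintegral_const_mul' _ _ (by simp)]
  simp only [h1]
  rw [lintegral_lintegral_swap]
  · rfl
  · exact ((((measurable_deriv f).comp measurable_fst).enorm.pow_const 2).mul
      measurable_localKernel).aemeasurable

/-- The weighted Dirichlet integral on the disc. -/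
noncomputable def weightedDirichlet (μ : Measure ClosedDisc) (f : ℂ → ℂ) : ℝ≥0∞ :=
  ∫⁻ w, ‖deriv f w‖ₑ ^ 2 * weight μ w ∂area

theorem measurable_localDirichlet (f : ℂ → ℂ) :
    Measurable fun ζ : ClosedDisc => localDirichlet ζ f :=
  ((((measurable_deriv f).comp measurable_fst).enorm.pow_const 2).mul
    measurable_localKernel).lintegral_prod_left'

theorem weightedDirichlet_id_mul_le (μ : Measure ClosedDisc) [IsFiniteMeasure μ] {f : ℂ → ℂ}
    (hf : DifferentiableOn ℂ f disc) :
    weightedDirichlet μ (fun w => w * f w)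
      ≤ 24 * weightedDirichlet μ f + 2 * ‖f 0‖ₑ ^ 2 * μ univ := by
  simp only [weightedDirichlet, lintegral_weight]
  calc _ ≤ ∫⁻ ζ : ClosedDisc, (24 * localDirichlet ζ f + 2 * ‖f 0‖ₑ ^ 2) ∂μ :=
        lintegral_mono fun ζ => localDirichlet_id_mul_le hf (norm_closedDisc_le ζ)
    _ = _ := by
        rw [lintegral_add_right _ measurable_const, lintegral_const,
          lintegral_const_mul _ (measurable_localDirichlet f)]

theorem weightedDirichlet_le_id_mul (μ : Measure ClosedDisc) [IsFiniteMeasure μ] {f : ℂ → ℂ}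
    (hf : DifferentiableOn ℂ f disc) :
    weightedDirichlet μ f ≤ 8 * weightedDirichlet μ (fun w => w * f w) := by
  simp only [weightedDirichlet, lintegral_weight]
  rw [← lintegral_const_mul _ (measurable_localDirichlet _)]
  exact lintegral_mono fun ζ => localDirichlet_le_id_mul hf (norm_closedDisc_le ζ)

theorem weightedDirichlet_id_mul_polynomial (μ : Measure ClosedDisc) [IsFiniteMeasure μ]
    (p : Polynomial ℂ) :
    weightedDirichlet μ (fun w => w * p.eval w)
      = weightedDirichlet μ (fun w => p.eval w) + ∫⁻ ζ : ClosedDisc, ‖p.eval (ζ : ℂ)‖ₑ ^ 2 ∂μ := by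
  simp only [weightedDirichlet, lintegral_weight]
  rw [← lintegral_add_left (measurable_localDirichlet _)]
  exact lintegral_congr fun ζ => localDirichlet_id_mul_polynomial p (norm_closedDisc_le ζ)

theorem weightedDirichlet_polynomial_lt_top (μ : Measure ClosedDisc) [IsFiniteMeasure μ]
    (p : Polynomial ℂ) : weightedDirichlet μ (fun w => p.eval w) < ⊤ := by
  obtain ⟨M, hM⟩ := exists_norm_deriv_polynomial_le p
  have h : ∀ ζ : ClosedDisc, localDirichlet ζ (fun w => p.eval w) ≤ ENNReal.ofReal (M ^ 2) := by
    intro ζ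
    calc _ ≤ ∫⁻ w, ENNReal.ofReal (M ^ 2) * localKernel ζ w ∂area := by
          refine lintegral_mono_ae ?_
          filter_upwards [ae_area_mem] with w hw
          gcongr
          rw [enorm_sq_eq_ofReal]
          exact ENNReal.ofReal_le_ofReal (pow_le_pow_left₀ (norm_nonneg _) (hM w hw) 2)
      _ = _ := by
          rw [lintegral_const_mul' _ _ ENNReal.ofReal_ne_top,
            lintegral_localKernel (norm_closedDisc_le ζ), mul_one]
  rw [weightedDirichlet, lintegral_weight]
  refine (lintegral_mono h).trans_lt ?_
  rw [lintegral_const]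
  exact ENNReal.mul_lt_top ENNReal.ofReal_lt_top (measure_lt_top μ _)

/-! ### Holomorphic parameter integrals and division by a coordinate. -/

theorem clm_prod_eq (L : ℂ × ℂ →L[ℂ] ℂ) :
    L = L (1, 0) • ContinuousLinearMap.fst ℂ ℂ ℂ + L (0, 1) • ContinuousLinearMap.snd ℂ ℂ ℂ := by
  refine ContinuousLinearMap.ext fun v => ?_
  have : v = v.1 • ((1, 0) : ℂ × ℂ) + v.2 • ((0, 1) : ℂ × ℂ) := by ext <;> simp
  conv_lhs => rw [this, map_add, map_smul, map_smul]
  simp [mul_comm]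

/-- By `clm_prod_eq` two directional derivatives suffice, and these are pointwise limits of
difference quotients. -/
theorem aestronglyMeasurable_fderiv_param {U : Set (ℂ × ℂ)} (hU : IsOpen U) {a b : ℝ}
    {F : ℂ × ℂ → ℝ → ℂ} (hc : ∀ x ∈ U, ContinuousOn (F x) (Icc a b))
    (hd : ∀ t ∈ Icc a b, DifferentiableOn ℂ (fun x => F x t) U) {x : ℂ × ℂ} (hx : x ∈ U) :
    AEStronglyMeasurable (fun t => fderiv ℂ (fun x => F x t) x) (volume.restrict (Icc a b)) := by
  have key : ∀ v : ℂ × ℂ, AEStronglyMeasurable (fun t => fderiv ℂ (fun x => F x t) x v)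
      (volume.restrict (Icc a b)) := by
    intro v
    let e : ℕ → ℂ := fun n => 1 / ((n : ℂ) + 1)
    have he : Tendsto e atTop (𝓝 0) := tendsto_one_div_add_atTop_nhds_zero_nat
    have hmem : ∀ᶠ n in atTop, x + e n • v ∈ U := by
      have : Tendsto (fun n => x + e n • v) atTop (𝓝 (x + (0 : ℂ) • v)) :=
        (he.smul_const v).const_add x
      rw [zero_smul, add_zero] at this
      exact this.eventually (hU.mem_nhds hx)
    -- The index is shifted by `N` so that every displaced point lies in `U`.
    obtain ⟨N, hN⟩ := eventually_atTop.1 hmem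
    refine aestronglyMeasurable_of_tendsto_ae atTop
      (f := fun n t => (e (n + N))⁻¹ • (F (x + e (n + N) • v) t - F x t)) (fun n => ?_) ?_
    · have h1 := (hc _ (hN (n + N) (by omega))).sub (hc x hx)
      exact (h1.const_smul (e (n + N))⁻¹).aestronglyMeasurable measurableSet_Icc
    · filter_upwards [ae_restrict_mem measurableSet_Icc] with t ht
      have h1 : HasFDerivAt (fun x => F x t) (fderiv ℂ (fun x => F x t) x) x :=
        ((hd t ht x hx).differentiableAt (hU.mem_nhds hx)).hasFDerivAt
      have h2 := (h1.hasLineDerivAt v).tendsto_slope_zero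
      refine h2.comp (tendsto_nhdsWithin_iff.2 ⟨he.comp (tendsto_add_atTop_nat N), ?_⟩)
      exact Eventually.of_forall fun n => one_div_ne_zero (Nat.cast_add_one_ne_zero (n + N))
  have h1 : (fun t => fderiv ℂ (fun x => F x t) x) = fun t =>
      fderiv ℂ (fun x => F x t) x (1, 0) • ContinuousLinearMap.fst ℂ ℂ ℂ
        + fderiv ℂ (fun x => F x t) x (0, 1) • ContinuousLinearMap.snd ℂ ℂ ℂ :=
    funext fun t => clm_prod_eq _
  rw [h1]
  exact ((key _).smul_const _).add ((key _).smul_const _)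

/-- An integral depending holomorphically on a parameter in `ℂ²` is holomorphic. -/
theorem differentiableOn_intervalIntegral {U : Set (ℂ × ℂ)} (hU : IsOpen U) {a b : ℝ} (hab : a ≤ b)
    {F : ℂ × ℂ → ℝ → ℂ} (hc : ContinuousOn (Function.uncurry F) (U ×ˢ Icc a b))
    (hd : ∀ t ∈ Icc a b, DifferentiableOn ℂ (fun x => F x t) U) :
    DifferentiableOn ℂ (fun x => ∫ t in a..b, F x t) U := by
  intro x hx
  obtain ⟨ε, hε, hεU⟩ := Metric.isOpen_iff.1 hU x hx
  set δ := ε / 4 with hδ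
  have hδ0 : 0 < δ := by positivity
  have hK : Metric.closedBall x (2 * δ) ⊆ U := fun y hy => hεU (by
    rw [Metric.mem_closedBall] at hy
    rw [Metric.mem_ball]; linarith)
  have hcs : ∀ y ∈ U, ContinuousOn (F y) (Icc a b) := fun y hy =>
    hc.comp (f := fun t => (y, t)) (by fun_prop) (fun t ht => ⟨hy, ht⟩)
  obtain ⟨M, hM⟩ := ((isCompact_closedBall x (2 * δ)).prod (isCompact_Icc (a := a) (b := b)))
    |>.exists_bound_of_continuousOn (hc.mono (prod_mono_left hK))
  have hball : Metric.ball x δ ⊆ U := fun y hy => hK (by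
    rw [Metric.mem_ball] at hy
    rw [Metric.mem_closedBall]; linarith)
  simp only [intervalIntegral.integral_of_le hab, ← integral_Icc_eq_integral_Ioc]
  refine (hasFDerivAt_integral_of_dominated_of_fderiv_le (𝕜 := ℂ) (bound := fun _ => 2 * M / δ)
    (F' := fun x t => fderiv ℂ (fun x => F x t) x)
    (Metric.ball_mem_nhds x hδ0) ?_ ?_ ?_ ?_ ?_ ?_).differentiableAt.differentiableWithinAt
  · filter_upwards [hU.mem_nhds hx] with y hy
    exact (hcs y hy).aestronglyMeasurable measurableSet_Icc
  · exact (hcs x hx).integrableOn_Icc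
  · exact aestronglyMeasurable_fderiv_param hU hcs hd hx
  -- Cauchy's estimate on a ball of radius `δ`, on which `F` varies from its central value by at
  -- most `2 * M`.
  · filter_upwards [ae_restrict_mem measurableSet_Icc] with t ht y hy
    have hsub : Metric.ball y δ ⊆ Metric.closedBall x (2 * δ) := fun z hz => by
      rw [Metric.mem_ball] at hy hz
      rw [Metric.mem_closedBall]
      linarith [dist_triangle z y x]
    refine Complex.norm_fderiv_le_div_of_mapsTo_ball ((hd t ht).mono (hsub.trans hK))
      (fun z hz => ?_) hδ0
    have h1 := hM (z, t) ⟨hsub hz, ht⟩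
    have h2 := hM (y, t) ⟨hsub (Metric.mem_ball_self hδ0), ht⟩
    simp only [Function.uncurry_apply_pair] at h1 h2
    rw [Metric.mem_closedBall, dist_eq_norm]
    linarith [norm_sub_le (F z t) (F y t)]
  · exact integrable_const _
  · filter_upwards [ae_restrict_mem measurableSet_Icc] with t ht y hy
    exact ((hd t ht y (hball hy)).differentiableAt (hU.mem_nhds (hball hy))).hasFDerivAt

/-- Partial derivatives of holomorphic functions on the bidisc are holomorphic. -/
theorem differentiableOn_partialDeriv {f : ℂ × ℂ → ℂ} (hf : DifferentiableOn ℂ f bidisc) :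
    DifferentiableOn ℂ (fun z : ℂ × ℂ => deriv (fun w => f (w, z.2)) z.1) bidisc := by
  rintro ⟨z₀, v₀⟩ ⟨hz₀, hv₀⟩
  obtain ⟨ε, hε, hεU⟩ := Metric.isOpen_iff.1 isOpen_disc z₀ hz₀
  set δ := ε / 4 with hδ
  have hδ0 : 0 < δ := by positivity
  have hsub : ∀ z ∈ Metric.ball z₀ δ, Metric.closedBall z δ ⊆ disc := fun z hz w hw => hεU (by
    rw [Metric.mem_ball] at hz ⊢
    rw [Metric.mem_closedBall] at hw
    linarith [dist_triangle w z z₀])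
  have hU : IsOpen (Metric.ball z₀ δ ×ˢ disc) := Metric.isOpen_ball.prod isOpen_disc
  have hmem : ∀ x ∈ Metric.ball z₀ δ ×ˢ disc, ∀ θ, (circleMap x.1 δ θ, x.2) ∈ bidisc :=
    fun x hx θ => ⟨hsub _ hx.1 (circleMap_mem_closedBall _ hδ0.le θ), hx.2⟩
  -- Cauchy's formula for the derivative, on a circle of fixed radius whose centre moves with the
  -- parameter.
  have hG : DifferentiableOn ℂ (fun x : ℂ × ℂ => (2 * Real.pi * Complex.I : ℂ)⁻¹ *
      ∫ θ in (0 : ℝ)..2 * Real.pi, (circleMap 0 δ θ * Complex.I) * ((circleMap 0 δ θ ^ 2)⁻¹ *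
        f (circleMap x.1 δ θ, x.2))) (Metric.ball z₀ δ ×ˢ disc) := by
    refine DifferentiableOn.const_mul (differentiableOn_intervalIntegral hU (by positivity) ?_ ?_) _
    · have hcirc : Continuous fun p : (ℂ × ℂ) × ℝ => circleMap p.1.1 δ p.2 := by
        unfold circleMap; fun_prop
      have h1 : ContinuousOn (fun p : (ℂ × ℂ) × ℝ => f (circleMap p.1.1 δ p.2, p.1.2))
          ((Metric.ball z₀ δ ×ˢ disc) ×ˢ Icc 0 (2 * Real.pi)) :=
        hf.continuousOn.comp (f := fun p : (ℂ × ℂ) × ℝ => (circleMap p.1.1 δ p.2, p.1.2))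
          (by fun_prop) (fun p hp => hmem p.1 hp.1 p.2)
      have h2 : Continuous fun p : (ℂ × ℂ) × ℝ => circleMap 0 δ p.2 :=
        (continuous_circleMap 0 δ).comp continuous_snd
      have h3 : Continuous fun p : (ℂ × ℂ) × ℝ => (circleMap 0 δ p.2 ^ 2)⁻¹ :=
        (h2.pow 2).inv₀ fun p => pow_ne_zero _ (circleMap_ne_center hδ0.ne')
      exact (h2.mul continuous_const).continuousOn.mul (h3.continuousOn.mul h1)
    · intro θ _
      refine DifferentiableOn.const_mul (DifferentiableOn.const_mul ?_ _) _
      refine hf.comp (f := fun x : ℂ × ℂ => (circleMap x.1 δ θ, x.2)) ?_ (fun x hx => hmem x hx θ)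
      unfold circleMap
      fun_prop
  have heq : ∀ x ∈ Metric.ball z₀ δ ×ˢ disc, deriv (fun w => f (w, x.2)) x.1
      = (2 * Real.pi * Complex.I : ℂ)⁻¹ *
      ∫ θ in (0 : ℝ)..2 * Real.pi, (circleMap 0 δ θ * Complex.I) * ((circleMap 0 δ θ ^ 2)⁻¹ *
        f (circleMap x.1 δ θ, x.2)) := by
    intro x hx
    have hdx : DifferentiableOn ℂ (fun w => f (w, x.2)) disc :=
      hf.comp (f := fun w : ℂ => (w, x.2)) (by fun_prop) fun w hw => ⟨hw, hx.2⟩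
    rw [← Complex.cderiv_eq_deriv isOpen_disc hdx hδ0 (hsub _ hx.1), Complex.cderiv,
      circleIntegral]
    simp [deriv_circleMap, circleMap_sub_center]
  have hx : ((z₀, v₀) : ℂ × ℂ) ∈ Metric.ball z₀ δ ×ˢ disc := ⟨Metric.mem_ball_self hδ0, hv₀⟩
  refine (DifferentiableAt.congr_of_eventuallyEq ((hG _ hx).differentiableAt (hU.mem_nhds hx))
    ?_).differentiableWithinAt
  filter_upwards [hU.mem_nhds hx] with x hx using heq x hx

theorem IsHolo.differentiableOn_slice {f : ℂ × ℂ → ℂ} (hf : IsHolo f) {v : ℂ} (hv : v ∈ disc) :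
    DifferentiableOn ℂ (fun w => f (w, v)) disc :=
  fun _ hw => (hf.differentiableAt_slice hw hv).differentiableWithinAt

theorem IsHolo.differentiableOn_slice' {f : ℂ × ℂ → ℂ} (hf : IsHolo f) {v : ℂ} (hv : v ∈ disc) :
    DifferentiableOn ℂ (fun w => f (v, w)) disc :=
  hf.swap.differentiableOn_slice hv

theorem IsHolo.differentiableOn_partialDeriv_slice {f : ℂ × ℂ → ℂ} (hf : IsHolo f) {z : ℂ}
    (hz : z ∈ disc) : DifferentiableOn ℂ (fun v => deriv (fun w => f (w, v)) z) disc :=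
  (differentiableOn_partialDeriv hf.diff).comp (f := fun v : ℂ => (z, v)) (by fun_prop)
    fun _ hv => ⟨hz, hv⟩

theorem zero_mem_disc : (0 : ℂ) ∈ disc := by simp [disc]

/-- A holomorphic function on the bidisc that vanishes for `z₁ = 0` is divisible by `z₁`. -/
theorem IsHolo.exists_eq_fst_mul {f : ℂ × ℂ → ℂ} (hf : IsHolo f) (h0 : ∀ v, f (0, v) = 0) :
    ∃ k, IsHolo k ∧ f = fun z => z.1 * k z := by
  classical
  -- The quotient `f / z₁` as an average of `∂₁ f` along a segment, which is holomorphic across `z₁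
  -- = 0`.
  let K : ℂ × ℂ → ℂ := fun z => ∫ t in (0 : ℝ)..1, deriv (fun w => f (w, z.2)) (t * z.1)
  have hmem : ∀ z ∈ bidisc, ∀ t ∈ Icc (0 : ℝ) 1, ((t : ℂ) * z.1, z.2) ∈ bidisc := by
    intro z hz t ht
    refine ⟨?_, hz.2⟩
    have h1 := mem_disc.1 hz.1
    rw [mem_disc, norm_mul, Complex.norm_real, Real.norm_of_nonneg ht.1]
    nlinarith [ht.2, norm_nonneg z.1]
  have hp := differentiableOn_partialDeriv hf.diff
  have hK : DifferentiableOn ℂ K bidisc := by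
    refine differentiableOn_intervalIntegral isOpen_bidisc zero_le_one ?_ ?_
    · exact hp.continuousOn.comp (f := fun p : (ℂ × ℂ) × ℝ => ((p.2 : ℂ) * p.1.1, p.1.2))
        (by fun_prop) fun p hp => hmem p.1 hp.1 p.2 hp.2
    · intro t ht
      exact hp.comp (f := fun z : ℂ × ℂ => ((t : ℂ) * z.1, z.2)) (by fun_prop)
        fun z hz => hmem z hz t ht
  refine ⟨bidisc.piecewise K 0, ⟨hK.congr fun z hz => piecewise_eq_of_mem _ _ _ hz, fun z hz =>
    by rw [piecewise_eq_of_notMem _ _ _ hz]; rfl⟩, ?_⟩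
  ext z
  by_cases hz : z ∈ bidisc
  · rw [piecewise_eq_of_mem _ _ _ hz]
    have hder : ∀ t ∈ uIcc (0 : ℝ) 1, HasDerivAt (fun t : ℝ => f ((t : ℂ) * z.1, z.2))
        (deriv (fun w => f (w, z.2)) (t * z.1) * z.1) t := by
      intro t ht
      rw [uIcc_of_le zero_le_one] at ht
      have h1 := (hf.differentiableAt_slice (hmem z hz t ht).1 hz.2).hasDerivAt
      have h2 : HasDerivAt (fun t : ℂ => t * z.1) z.1 (t : ℂ) := by
        simpa using (hasDerivAt_id (t : ℂ)).mul_const z.1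
      exact (HasDerivAt.comp (t : ℂ) h1 h2).comp_ofReal
    have hcont : ContinuousOn (fun t : ℝ => deriv (fun w => f (w, z.2)) (t * z.1) * z.1)
        (uIcc (0 : ℝ) 1) := by
      rw [uIcc_of_le zero_le_one]
      exact (hp.continuousOn.comp (f := fun t : ℝ => ((t : ℂ) * z.1, z.2)) (by fun_prop)
        fun t ht => hmem z hz t ht).mul continuousOn_const
    have := intervalIntegral.integral_eq_sub_of_hasDerivAt hder hcont.intervalIntegrable
    rw [intervalIntegral.integral_mul_const] at this
    simp only [Complex.ofReal_one, one_mul, Complex.ofReal_zero, zero_mul, h0, sub_zero] at this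
    rw [mul_comm]
    exact this.symm
  · rw [piecewise_eq_of_notMem _ _ _ hz, hf.zero_off z hz]
    simp

/-! ### Multiplication by the coordinates preserves the Dirichlet-type space. -/

theorem sliceIntegral_eq_weightedDirichlet (μ : Measure ClosedDisc) (f : ℂ × ℂ → ℂ) :
    sliceIntegral μ f
      = ⨆ r ∈ Ioo (0 : ℝ) 1, ∫⁻ θ, weightedDirichlet μ (fun w => f (w, polar r θ)) ∂angle := rfl

theorem le_sliceIntegral (μ : Measure ClosedDisc) (f : ℂ × ℂ → ℂ) {r : ℝ}
    (hr : r ∈ Ioo (0 : ℝ) 1) :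
    ∫⁻ θ, weightedDirichlet μ (fun w => f (w, polar r θ)) ∂angle ≤ sliceIntegral μ f :=
  le_iSup₂ (f := fun r (_ : r ∈ Ioo (0 : ℝ) 1) =>
    ∫⁻ θ, weightedDirichlet μ (fun w => f (w, polar r θ)) ∂angle) r hr

theorem le_hardyNormSq (f : ℂ × ℂ → ℂ) {r : ℝ} (hr : r ∈ Ioo (0 : ℝ) 1) :
    ∫⁻ α, circleMean (fun w => f (polar r α, w)) r ∂angle ≤ hardyNormSq f :=
  le_iSup₂ (f := fun r (_ : r ∈ Ioo (0 : ℝ) 1) =>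
    ∫⁻ α, circleMean (fun w => f (polar r α, w)) r ∂angle) r hr

theorem lintegral_torus_swap {f : ℂ × ℂ → ℂ} (hf : Measurable f) (r s : ℝ) :
    ∫⁻ α, circleMean (fun w => f (polar r α, w)) s ∂angle
      = ∫⁻ β, circleMean (fun w => f (w, polar s β)) r ∂angle := by
  refine lintegral_lintegral_swap (Measurable.aemeasurable ?_)
  refine (hf.comp (Measurable.prodMk ?_ ?_)).enorm.pow_const 2
  · exact (continuous_polar r).measurable.comp measurable_fst
  · exact (continuous_polar s).measurable.comp measurable_snd

theorem hardyNormSq_swap {f : ℂ × ℂ → ℂ} (hf : Measurable f) :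
    hardyNormSq (fun z => f (z.2, z.1)) = hardyNormSq f := by
  refine iSup_congr fun r => iSup_congr fun _ => ?_
  exact (lintegral_torus_swap hf r r).symm

theorem dirichletIntegral_swap (μ₁ μ₂ : Measure ClosedDisc) (f : ℂ × ℂ → ℂ) :
    dirichletIntegral μ₁ μ₂ (fun z => f (z.2, z.1)) = dirichletIntegral μ₂ μ₁ f := by
  unfold dirichletIntegral
  rw [add_comm]

theorem lintegral_zero_slice_le {f : ℂ × ℂ → ℂ} (hf : IsHolo f) {r : ℝ}
    (hr : r ∈ Ioo (0 : ℝ) 1) : ∫⁻ θ, ‖f (0, polar r θ)‖ₑ ^ 2 ∂angle ≤ hardyNormSq f := by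
  refine le_trans ?_ (le_hardyNormSq f hr)
  rw [lintegral_torus_swap hf.measurable]
  exact lintegral_mono fun θ => enorm_zero_sq_le_circleMean
    (hf.differentiableOn_slice (polar_mem hr θ)) hr

theorem IsHolo.fst_mul {f : ℂ × ℂ → ℂ} (hf : IsHolo f) : IsHolo fun z => z.1 * f z :=
  ⟨differentiableOn_fst.mul hf.diff, fun z hz => by simp [hf.zero_off z hz]⟩

/-- The one-variable estimate on each slice; the extra terms `|f(0, ·)|²` integrate to at most the
Hardy norm. -/
theorem sliceIntegral_fst_mul_le (μ : Measure ClosedDisc) [IsFiniteMeasure μ] {f : ℂ × ℂ → ℂ}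
    (hf : IsHolo f) : sliceIntegral μ (fun z => z.1 * f z)
      ≤ 24 * sliceIntegral μ f + 2 * μ univ * hardyNormSq f := by
  rw [sliceIntegral_eq_weightedDirichlet]
  refine iSup₂_le fun r hr => ?_
  have hm : Measurable fun θ => ‖f (0, polar r θ)‖ₑ ^ 2 :=
    (hf.measurable.comp (measurable_const.prodMk (continuous_polar r).measurable)).enorm.pow_const 2
  calc ∫⁻ θ, weightedDirichlet μ (fun w => w * f (w, polar r θ)) ∂angle
      ≤ ∫⁻ θ, (24 * weightedDirichlet μ (fun w => f (w, polar r θ))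
          + 2 * μ univ * ‖f (0, polar r θ)‖ₑ ^ 2) ∂angle := by
        refine lintegral_mono fun θ => ?_
        refine (weightedDirichlet_id_mul_le μ
          (hf.differentiableOn_slice (polar_mem hr θ))).trans (le_of_eq ?_)
        ring
    _ = 24 * (∫⁻ θ, weightedDirichlet μ (fun w => f (w, polar r θ)) ∂angle)
          + 2 * μ univ * ∫⁻ θ, ‖f (0, polar r θ)‖ₑ ^ 2 ∂angle := by
        rw [lintegral_add_right _ (hm.const_mul _), lintegral_const_mul' _ _ (by simp),
          lintegral_const_mul _ hm]
    _ ≤ _ := by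
        gcongr
        · exact le_sliceIntegral μ f hr
        · exact lintegral_zero_slice_le hf hr

theorem sliceIntegral_snd_mul_le (μ : Measure ClosedDisc) (f : ℂ × ℂ → ℂ) :
    sliceIntegral μ (fun z => z.2 * f z) ≤ sliceIntegral μ f := by
  refine iSup₂_mono fun r hr => lintegral_mono fun θ => lintegral_mono fun z => ?_
  simp only
  rw [deriv_const_mul_field, enorm_mul, mul_pow]
  gcongr
  refine mul_le_of_le_one_left' (pow_le_one' ?_ 2)
  rw [← ofReal_norm, ENNReal.ofReal_le_one, norm_polar, abs_of_pos hr.1]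
  exact hr.2.le

theorem hardyNormSq_fst_mul_le (f : ℂ × ℂ → ℂ) :
    hardyNormSq (fun z => z.1 * f z) ≤ hardyNormSq f := by
  refine iSup₂_mono fun r hr => lintegral_mono fun θ => lintegral_mono fun z => ?_
  simp only
  rw [enorm_mul, mul_pow]
  refine mul_le_of_le_one_left' (pow_le_one' ?_ 2)
  rw [← ofReal_norm, ENNReal.ofReal_le_one, norm_polar, abs_of_pos hr.1]
  exact hr.2.le

section Space

variable {μ₁ μ₂ : Measure ClosedDisc} [IsFiniteMeasure μ₁] [IsFiniteMeasure μ₂]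

theorem mem_dirichletSpace {f : ℂ × ℂ → ℂ} : f ∈ DirichletSpace μ₁ μ₂ ↔
    IsHolo f ∧ hardyNormSq f < ⊤ ∧ sliceIntegral μ₁ f < ⊤
      ∧ sliceIntegral μ₂ (fun z => f (z.2, z.1)) < ⊤ := by
  rw [← ENNReal.add_lt_top]
  rfl

theorem swap_mem {f : ℂ × ℂ → ℂ} (hf : f ∈ DirichletSpace μ₁ μ₂) :
    (fun z => f (z.2, z.1)) ∈ DirichletSpace μ₂ μ₁ := by
  obtain ⟨h1, h2, h3⟩ := hf
  refine ⟨h1.swap, ?_, ?_⟩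
  · rwa [hardyNormSq_swap h1.measurable]
  · rwa [dirichletIntegral_swap]

theorem fst_mul_mem {f : ℂ × ℂ → ℂ} (hf : f ∈ DirichletSpace μ₁ μ₂) :
    (fun z => z.1 * f z) ∈ DirichletSpace μ₁ μ₂ := by
  rw [mem_dirichletSpace] at hf ⊢
  obtain ⟨h1, h2, h3, h4⟩ := hf
  refine ⟨h1.fst_mul, (hardyNormSq_fst_mul_le f).trans_lt h2,
    (sliceIntegral_fst_mul_le μ₁ h1).trans_lt ?_,
    (sliceIntegral_snd_mul_le μ₂ fun z => f (z.2, z.1)).trans_lt h4⟩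
  exact ENNReal.add_lt_top.2 ⟨ENNReal.mul_lt_top (by simp) h3,
    ENNReal.mul_lt_top (ENNReal.mul_lt_top (by simp) (measure_lt_top _ _)) h2⟩

theorem snd_mul_mem {f : ℂ × ℂ → ℂ} (hf : f ∈ DirichletSpace μ₁ μ₂) :
    (fun z => z.2 * f z) ∈ DirichletSpace μ₁ μ₂ :=
  swap_mem (fst_mul_mem (swap_mem hf))

end Space

/-! ### Bounded division and the ideal of functions vanishing at the origin. -/

theorem sliceIntegral_le_fst_mul (μ : Measure ClosedDisc) [IsFiniteMeasure μ] {k : ℂ × ℂ → ℂ}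
    (hk : IsHolo k) : sliceIntegral μ k ≤ 8 * sliceIntegral μ (fun z => z.1 * k z) := by
  rw [sliceIntegral_eq_weightedDirichlet]
  refine iSup₂_le fun r hr => ?_
  calc ∫⁻ θ, weightedDirichlet μ (fun w => k (w, polar r θ)) ∂angle
      ≤ ∫⁻ θ, 8 * weightedDirichlet μ (fun w => w * k (w, polar r θ)) ∂angle :=
        lintegral_mono fun θ => weightedDirichlet_le_id_mul μ
          (hk.differentiableOn_slice (polar_mem hr θ))
    _ ≤ _ := by
        rw [lintegral_const_mul' _ _ (by simp)]
        gcongr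
        exact le_sliceIntegral μ (fun z => z.1 * k z) hr

/-- On a circle of radius at least `1 / 2`, dividing by the coordinate costs at most a factor `4` in
the mean square; monotonicity allows enlarging the radius. -/
theorem exists_radius_ge {r : ℝ} (hr : r ∈ Ioo (0 : ℝ) 1) :
    ∃ s ∈ Ioo (0 : ℝ) 1, r ≤ s ∧ 1 / 2 ≤ s :=
  ⟨max r (1 / 2), ⟨hr.1.trans_le (le_max_left _ _), max_lt hr.2 (by norm_num)⟩,
    le_max_left _ _, le_max_right _ _⟩

theorem enorm_sq_le_four_mul {s : ℝ} (hs : 1 / 2 ≤ s) (θ : ℝ) (a : ℂ) :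
    ‖a‖ₑ ^ 2 ≤ 4 * ‖polar s θ * a‖ₑ ^ 2 := by
  rw [enorm_sq_eq_ofReal, enorm_sq_eq_ofReal, ← ENNReal.ofReal_ofNat,
    ← ENNReal.ofReal_mul (by norm_num), norm_mul, norm_polar, abs_of_pos (by linarith)]
  refine ENNReal.ofReal_le_ofReal ?_
  have : 1 ≤ 4 * s ^ 2 := by nlinarith
  nlinarith [sq_nonneg ‖a‖]

/-- The area integrals of `sliceIntegral` in the reverse order. -/
theorem lintegral_weightedDirichlet_slice (μ : Measure ClosedDisc) [IsFiniteMeasure μ]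
    {k : ℂ × ℂ → ℂ} (hk : IsHolo k) {r : ℝ} (hr : r ∈ Ioo (0 : ℝ) 1) :
    ∫⁻ θ, weightedDirichlet μ (fun w => k (w, polar r θ)) ∂angle
      = ∫⁻ z, circleMean (fun v => deriv (fun w => k (w, v)) z) r * weight μ z ∂area := by
  have h1 : ∀ θ, weightedDirichlet μ (fun w => k (w, polar r θ))
      = ∫⁻ z, sliceDensity μ k (z, polar r θ) ∂area := fun θ => by
    refine lintegral_congr_ae ?_
    filter_upwards [ae_area_mem] with z hz
    have : (z, polar r θ) ∈ bidisc := ⟨hz, polar_mem hr θ⟩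
    simp [sliceDensity, this]
  simp only [h1]
  have hmeas : Measurable fun p : ℝ × ℂ => sliceDensity μ k (p.2, polar r p.1) :=
    (measurable_sliceDensity μ hk).comp
      (measurable_snd.prodMk ((continuous_polar r).measurable.comp measurable_fst))
  rw [lintegral_lintegral_swap hmeas.aemeasurable]
  refine lintegral_congr_ae ?_
  filter_upwards [ae_area_mem] with z hz
  have h2 : ∀ θ, sliceDensity μ k (z, polar r θ)
      = ‖deriv (fun w => k (w, polar r θ)) z‖ₑ ^ 2 * weight μ z := fun θ => by
    have : (z, polar r θ) ∈ bidisc := ⟨hz, polar_mem hr θ⟩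
    simp [sliceDensity, this]
  simp only [h2]
  rw [lintegral_mul_const'']
  · rfl
  · refine (Continuous.measurable ?_).enorm.pow_const 2 |>.aemeasurable
    exact (hk.differentiableOn_partialDeriv_slice hz).continuousOn.comp_continuous
      (continuous_polar r) fun θ => polar_mem hr θ

/-- With the integrals exchanged, the inner one is a circle mean of the holomorphic function `v ↦ ∂₁
k(z, v)`, hence increasing in the radius. -/
theorem sliceIntegral_le_snd_mul (μ : Measure ClosedDisc) [IsFiniteMeasure μ] {k : ℂ × ℂ → ℂ}
    (hk : IsHolo k) : sliceIntegral μ k ≤ 4 * sliceIntegral μ (fun z => z.2 * k z) := by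
  rw [sliceIntegral_eq_weightedDirichlet]
  refine iSup₂_le fun r hr => ?_
  obtain ⟨s, hs, hrs, hs2⟩ := exists_radius_ge hr
  calc ∫⁻ θ, weightedDirichlet μ (fun w => k (w, polar r θ)) ∂angle
      = _ := lintegral_weightedDirichlet_slice μ hk hr
    _ ≤ ∫⁻ z, circleMean (fun v => deriv (fun w => k (w, v)) z) s * weight μ z ∂area := by
        refine lintegral_mono_ae ?_
        filter_upwards [ae_area_mem] with z hz
        gcongr
        exact circleMean_mono (hk.differentiableOn_partialDeriv_slice hz) hr hs hrs
    _ = ∫⁻ θ, weightedDirichlet μ (fun w => k (w, polar s θ)) ∂angle :=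
        (lintegral_weightedDirichlet_slice μ hk hs).symm
    _ ≤ ∫⁻ θ, 4 * weightedDirichlet μ (fun w => polar s θ * k (w, polar s θ)) ∂angle := by
        refine lintegral_mono fun θ => ?_
        rw [weightedDirichlet, weightedDirichlet, ← lintegral_const_mul' _ _ (by simp)]
        refine lintegral_mono fun z => ?_
        simp only
        rw [deriv_const_mul_field, ← mul_assoc]
        gcongr
        exact enorm_sq_le_four_mul hs2 θ _
    _ ≤ _ := by
        rw [lintegral_const_mul' _ _ (by simp)]
        gcongr
        exact le_sliceIntegral μ (fun z => z.2 * k z) hs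

theorem torus_mono {k : ℂ × ℂ → ℂ} (hk : IsHolo k) {r s : ℝ} (hr : r ∈ Ioo (0 : ℝ) 1)
    (hs : s ∈ Ioo (0 : ℝ) 1) (hrs : r ≤ s) :
    ∫⁻ α, circleMean (fun w => k (polar r α, w)) r ∂angle
      ≤ ∫⁻ α, circleMean (fun w => k (polar s α, w)) s ∂angle := by
  calc _ ≤ ∫⁻ α, circleMean (fun w => k (polar r α, w)) s ∂angle :=
        lintegral_mono fun α => circleMean_mono
          (hk.differentiableOn_slice' (polar_mem hr α)) hr hs hrs
    _ = ∫⁻ β, circleMean (fun w => k (w, polar s β)) r ∂angle :=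
        lintegral_torus_swap hk.measurable r s
    _ ≤ ∫⁻ β, circleMean (fun w => k (w, polar s β)) s ∂angle :=
        lintegral_mono fun α => circleMean_mono
          (hk.differentiableOn_slice (polar_mem hs α)) hr hs hrs
    _ = _ := (lintegral_torus_swap hk.measurable s s).symm

theorem hardyNormSq_le_fst_mul {k : ℂ × ℂ → ℂ} (hk : IsHolo k) :
    hardyNormSq k ≤ 4 * hardyNormSq (fun z => z.1 * k z) := by
  refine iSup₂_le fun r hr => ?_
  obtain ⟨s, hs, hrs, hs2⟩ := exists_radius_ge hr
  calc _ ≤ _ := torus_mono hk hr hs hrs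
    _ ≤ ∫⁻ α, 4 * circleMean (fun w => polar s α * k (polar s α, w)) s ∂angle := by
        refine lintegral_mono fun α => ?_
        unfold circleMean
        rw [← lintegral_const_mul' _ _ (by simp)]
        exact lintegral_mono fun β => enorm_sq_le_four_mul hs2 α _
    _ ≤ _ := by
        rw [lintegral_const_mul' _ _ (by simp)]
        gcongr
        exact le_hardyNormSq (fun z => z.1 * k z) hs

/-- The function of `z₂` obtained by setting `z₁ = 0`, as a function on the bidisc. -/
noncomputable def restrictZero (f : ℂ × ℂ → ℂ) : ℂ × ℂ → ℂ := bidisc.indicator fun z => f (0, z.2)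

theorem restrictZero_apply {f : ℂ × ℂ → ℂ} {z : ℂ × ℂ} (hz : z ∈ bidisc) :
    restrictZero f z = f (0, z.2) := indicator_of_mem hz _

theorem IsHolo.restrictZero {f : ℂ × ℂ → ℂ} (hf : IsHolo f) : IsHolo (restrictZero f) := by
  refine ⟨?_, fun z hz => indicator_of_notMem hz _⟩
  refine DifferentiableOn.congr (f := fun z : ℂ × ℂ => f (0, z.2)) ?_
    fun z hz => restrictZero_apply hz
  exact hf.diff.comp (f := fun z : ℂ × ℂ => ((0 : ℂ), z.2)) (by fun_prop)
    fun z hz => ⟨zero_mem_disc, hz.2⟩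

theorem weightedDirichlet_congr (μ : Measure ClosedDisc) {f g : ℂ → ℂ} (h : EqOn f g disc) :
    weightedDirichlet μ f = weightedDirichlet μ g := by
  refine lintegral_congr_ae ?_
  filter_upwards [ae_area_mem] with z hz
  rw [(h.eventuallyEq_of_mem (isOpen_disc.mem_nhds hz)).deriv_eq]

theorem sliceIntegral_congr (μ : Measure ClosedDisc) {f g : ℂ × ℂ → ℂ} (h : EqOn f g bidisc) :
    sliceIntegral μ f = sliceIntegral μ g := by
  simp only [sliceIntegral_eq_weightedDirichlet]
  refine iSup_congr fun r => iSup_congr fun hr => lintegral_congr fun θ => ?_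
  exact weightedDirichlet_congr μ fun w hw => h ⟨hw, polar_mem hr θ⟩

theorem hardyNormSq_congr {f g : ℂ × ℂ → ℂ} (h : EqOn f g bidisc) :
    hardyNormSq f = hardyNormSq g := by
  refine iSup_congr fun r => iSup_congr fun hr => lintegral_congr fun α =>
    lintegral_congr fun β => ?_
  rw [h ⟨polar_mem hr α, polar_mem hr β⟩]

theorem sliceIntegral_restrictZero (μ : Measure ClosedDisc) (f : ℂ × ℂ → ℂ) :
    sliceIntegral μ (restrictZero f) = 0 := by
  rw [sliceIntegral_congr μ (g := fun z => f (0, z.2)) fun z hz => restrictZero_apply hz]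
  simp [sliceIntegral]

/-- Freezing `z₁ = 0` replaces a circle mean of the partial derivative by its value at the centre,
which is no larger. -/
theorem sliceIntegral_restrictZero_swap_le (μ : Measure ClosedDisc) [IsFiniteMeasure μ]
    {f : ℂ × ℂ → ℂ} (hf : IsHolo f) :
    sliceIntegral μ (fun z => restrictZero f (z.2, z.1))
      ≤ sliceIntegral μ fun z => f (z.2, z.1) := by
  rw [sliceIntegral_congr μ (g := fun z => f (0, z.1)) fun z hz =>
    restrictZero_apply ⟨hz.2, hz.1⟩, sliceIntegral_eq_weightedDirichlet]
  refine iSup₂_le fun r hr => le_trans ?_ (le_sliceIntegral μ _ hr)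
  rw [lintegral_weightedDirichlet_slice μ hf.swap hr]
  simp only [lintegral_const, measure_univ, mul_one]
  refine lintegral_mono_ae ?_
  filter_upwards [ae_area_mem] with z hz
  gcongr
  exact enorm_zero_sq_le_circleMean (hf.swap.differentiableOn_partialDeriv_slice hz) hr

theorem hardyNormSq_restrictZero_le {f : ℂ × ℂ → ℂ} (hf : IsHolo f) :
    hardyNormSq (restrictZero f) ≤ hardyNormSq f := by
  rw [hardyNormSq_congr (g := fun z => f (0, z.2)) fun z hz => restrictZero_apply hz]
  refine iSup₂_le fun r hr => ?_
  simp only [lintegral_const, measure_univ, mul_one]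
  exact lintegral_zero_slice_le hf hr

/-- The constant function on the bidisc. -/
noncomputable def oneFn : ℂ × ℂ → ℂ := bidisc.indicator fun _ => 1

theorem oneFn_apply {z : ℂ × ℂ} (hz : z ∈ bidisc) : oneFn z = 1 := indicator_of_mem hz _

theorem isHolo_oneFn : IsHolo oneFn :=
  ⟨(differentiableOn_const 1).congr fun _ hz => oneFn_apply hz,
    fun _ hz => indicator_of_notMem hz _⟩

section Space

variable {μ₁ μ₂ : Measure ClosedDisc} [IsFiniteMeasure μ₁] [IsFiniteMeasure μ₂]

theorem mem_of_fst_mul_mem {k : ℂ × ℂ → ℂ} (hk : IsHolo k)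
    (h : (fun z => z.1 * k z) ∈ DirichletSpace μ₁ μ₂) : k ∈ DirichletSpace μ₁ μ₂ := by
  rw [mem_dirichletSpace] at h ⊢
  obtain ⟨-, h2, h3, h4⟩ := h
  exact ⟨hk, (hardyNormSq_le_fst_mul hk).trans_lt (ENNReal.mul_lt_top (by simp) h2),
    (sliceIntegral_le_fst_mul μ₁ hk).trans_lt (ENNReal.mul_lt_top (by simp) h3),
    (sliceIntegral_le_snd_mul μ₂ hk.swap).trans_lt (ENNReal.mul_lt_top (by simp) h4)⟩

theorem restrictZero_mem {f : ℂ × ℂ → ℂ} (hf : f ∈ DirichletSpace μ₁ μ₂) :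
    restrictZero f ∈ DirichletSpace μ₁ μ₂ := by
  rw [mem_dirichletSpace] at hf ⊢
  obtain ⟨h1, h2, -, h4⟩ := hf
  exact ⟨h1.restrictZero, (hardyNormSq_restrictZero_le h1).trans_lt h2,
    by simp [sliceIntegral_restrictZero], (sliceIntegral_restrictZero_swap_le μ₂ h1).trans_lt h4⟩

theorem oneFn_mem : oneFn ∈ DirichletSpace μ₁ μ₂ := by
  rw [mem_dirichletSpace]
  refine ⟨isHolo_oneFn, ?_, ?_, ?_⟩
  · rw [hardyNormSq_congr (g := fun _ => 1) fun z hz => oneFn_apply hz]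
    refine lt_of_le_of_lt (iSup₂_le fun r _ => ?_) ENNReal.one_lt_top
    simp
  · rw [sliceIntegral_congr μ₁ (g := fun _ => 1) fun z hz => oneFn_apply hz]
    simp [sliceIntegral]
  · rw [sliceIntegral_congr μ₂ (g := fun _ => 1) fun z hz => oneFn_apply ⟨hz.2, hz.1⟩]
    simp [sliceIntegral]

theorem exists_eq_fst_mul_of_mem {f : ℂ × ℂ → ℂ} (hf : f ∈ DirichletSpace μ₁ μ₂)
    (h0 : ∀ v, f (0, v) = 0) : ∃ k ∈ DirichletSpace μ₁ μ₂, f = fun z => z.1 * k z := by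
  obtain ⟨k, hk, rfl⟩ := hf.1.exists_eq_fst_mul h0
  exact ⟨k, mem_of_fst_mul_mem hk hf, rfl⟩

theorem zero_mem_bidisc : ((0, 0) : ℂ × ℂ) ∈ bidisc := ⟨zero_mem_disc, zero_mem_disc⟩

/-- A function in the Dirichlet-type space vanishing at the origin lies in the ideal generated
by the coordinate functions. -/
theorem exists_eq_fst_mul_add_snd_mul {f : ℂ × ℂ → ℂ} (hf : f ∈ DirichletSpace μ₁ μ₂)
    (h0 : f (0, 0) = 0) : ∃ k₁ ∈ DirichletSpace μ₁ μ₂, ∃ k₂ ∈ DirichletSpace μ₁ μ₂,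
      f = (fun z => z.1 * k₁ z) + fun z => z.2 * k₂ z := by
  have hr := restrictZero_mem hf
  -- The difference `f - f(0, z₂)` vanishes on `z₁ = 0`, and `f(0, z₂)` vanishes on `z₂ = 0` because
  -- `f(0, 0) = 0`; each is divided separately.
  obtain ⟨k₁, hk₁, h1⟩ := exists_eq_fst_mul_of_mem (sub_mem hf hr) fun v => by
    by_cases hv : v ∈ disc
    · simp [restrictZero_apply (show ((0 : ℂ), v) ∈ bidisc from ⟨zero_mem_disc, hv⟩)]
    · have hv' : ((0 : ℂ), v) ∉ bidisc := fun h => hv h.2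
      simp [hf.1.zero_off _ hv', hr.1.zero_off _ hv']
  obtain ⟨k₂, hk₂, h2⟩ := exists_eq_fst_mul_of_mem (swap_mem hr) fun v => by
    by_cases hv : v ∈ disc
    · simp [restrictZero_apply (show (v, (0 : ℂ)) ∈ bidisc from ⟨hv, zero_mem_disc⟩), h0]
    · exact hr.1.zero_off _ fun h => hv h.1
  refine ⟨k₁, hk₁, fun z => k₂ (z.2, z.1), swap_mem hk₂, ?_⟩
  rw [← h1]
  have h3 : (fun z : ℂ × ℂ => z.2 * k₂ (z.2, z.1)) = restrictZero f := by
    ext z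
    exact (congrFun h2 (z.2, z.1)).symm
  rw [h3, sub_add_cancel]

end Space

/-! ### Orthogonality of the constants to the functions vanishing at the origin. -/

theorem taylorCoeff_add_const_succ (G : ℂ → ℂ) (c : ℂ) (n : ℕ) :
    taylorCoeff (fun w => G w + c) (n + 1) = taylorCoeff G (n + 1) := by
  have : deriv (fun w => G w + c) = deriv G := by ext; simp
  simp only [taylorCoeff, iteratedDeriv_succ', this]

/-- Only the zeroth Taylor coefficient changes. The additive form avoids subtraction in `ℝ≥0∞`. -/
theorem circleMean_add_const {G : ℂ → ℂ} (hG : DifferentiableOn ℂ G disc) (c : ℂ) {r : ℝ}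
    (hr : r ∈ Ioo (0 : ℝ) 1) :
    circleMean (fun w => G w + c) r + ‖G 0‖ₑ ^ 2 = circleMean G r + ‖G 0 + c‖ₑ ^ 2 := by
  have hG' : DifferentiableOn ℂ (fun w => G w + c) disc := hG.add_const c
  rw [circleMean_taylor hG hr, circleMean_taylor hG' hr, tsum_eq_zero_add' ENNReal.summable,
    tsum_eq_zero_add' (f := fun n => ‖taylorCoeff G n‖ₑ ^ 2 * _) ENNReal.summable]
  simp only [taylorCoeff_add_const_succ, taylorCoeff_zero, mul_zero, pow_zero, ENNReal.ofReal_one,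
    mul_one]
  ring

theorem circleMean_lt_top {G : ℂ → ℂ} (hG : DifferentiableOn ℂ G disc) {r : ℝ}
    (hr : r ∈ Ioo (0 : ℝ) 1) : circleMean G r < ⊤ := by
  obtain ⟨M, hM⟩ := (isCompact_closedBall (0 : ℂ) r).exists_bound_of_continuousOn
    (hG.continuousOn.mono (Metric.closedBall_subset_ball hr.2))
  calc circleMean G r ≤ ∫⁻ _, ENNReal.ofReal (M ^ 2) ∂angle := by
        refine lintegral_mono fun θ => ?_
        simp only
        rw [enorm_sq_eq_ofReal]
        refine ENNReal.ofReal_le_ofReal (pow_le_pow_left₀ (norm_nonneg _) (hM _ ?_) 2)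
        rw [mem_closedBall_zero_iff, norm_polar, abs_of_pos hr.1]
    _ < ⊤ := by simp

theorem eq_zero_of_circleMean_eq_zero {G : ℂ → ℂ} (hG : DifferentiableOn ℂ G disc) {r : ℝ}
    (hr : r ∈ Ioo (0 : ℝ) 1) (h : circleMean G r = 0) : ∀ w ∈ disc, G w = 0 := by
  intro w hw
  rw [circleMean_taylor hG hr, ENNReal.tsum_eq_zero] at h
  have hc : ∀ n, taylorCoeff G n = 0 := fun n => by
    rcases mul_eq_zero.1 (h n) with h1 | h1
    · simpa using h1
    · exact absurd (ENNReal.ofReal_eq_zero.1 h1) (not_le.2 (pow_pos hr.1 _))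
  have := hasSum_taylorCoeff hG w hw
  simp only [hc, zero_mul] at this
  exact this.unique hasSum_zero

/-- `circleMean_add_const` is used in the second variable, then on the slice `z₂ = 0`; the mean of
`h(·, 0)` is finite and cancels. -/
theorem torus_add_const {h : ℂ × ℂ → ℂ} (hh : IsHolo h) (h0 : h (0, 0) = 0) (c : ℂ) {r : ℝ}
    (hr : r ∈ Ioo (0 : ℝ) 1) :
    ∫⁻ α, circleMean (fun w => h (polar r α, w) + c) r ∂angle
      = ‖c‖ₑ ^ 2 + ∫⁻ α, circleMean (fun w => h (polar r α, w)) r ∂angle := by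
  have hs : DifferentiableOn ℂ (fun w => h (w, 0)) disc := hh.differentiableOn_slice zero_mem_disc
  have hm : Measurable fun α => h (polar r α, 0) :=
    hh.measurable.comp ((continuous_polar r).measurable.prodMk measurable_const)
  have h1 : ∫⁻ α, (circleMean (fun w => h (polar r α, w) + c) r + ‖h (polar r α, 0)‖ₑ ^ 2) ∂angle
      = ∫⁻ α, (circleMean (fun w => h (polar r α, w)) r + ‖h (polar r α, 0) + c‖ₑ ^ 2) ∂angle :=
    lintegral_congr fun α =>
      circleMean_add_const (hh.differentiableOn_slice' (polar_mem hr α)) c hr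
  rw [lintegral_add_right _ (hm.enorm.pow_const 2),
    lintegral_add_right _ ((hm.add_const c).enorm.pow_const 2)] at h1
  have h2 := circleMean_add_const hs c hr
  have h3 := circleMean_lt_top hs hr
  simp only [h0, enorm_zero, ne_eq, OfNat.ofNat_ne_zero, not_false_eq_true, zero_pow, add_zero,
    zero_add] at h2
  unfold circleMean at h2 h3
  rw [h2, add_comm (∫⁻ α, ‖h (polar r α, 0)‖ₑ ^ 2 ∂angle), ← add_assoc,
    ENNReal.add_left_inj h3.ne] at h1
  rw [h1, add_comm]

theorem Ioo_zero_one_nonempty : (Ioo (0 : ℝ) 1).Nonempty := nonempty_Ioo.2 zero_lt_one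

theorem hardyNormSq_const_add {h : ℂ × ℂ → ℂ} (hh : IsHolo h) (h0 : h (0, 0) = 0) (c : ℂ) :
    hardyNormSq (c • oneFn + h) = ‖c‖ₑ ^ 2 + hardyNormSq h := by
  rw [hardyNormSq_congr (g := fun z => h z + c) fun z hz => by
    simp [oneFn_apply hz, add_comm]]
  unfold hardyNormSq
  rw [ENNReal.add_biSup Ioo_zero_one_nonempty]
  exact iSup_congr fun r => iSup_congr fun hr => torus_add_const hh h0 c hr

theorem sliceIntegral_const_add (μ : Measure ClosedDisc) (h : ℂ × ℂ → ℂ) (c : ℂ) :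
    sliceIntegral μ (fun z => c + h z) = sliceIntegral μ h := by
  simp [sliceIntegral]

/-- Pythagoras stands in for an inner product: the Dirichlet part ignores constants, and the Hardy
part splits. -/
theorem normSq_const_add (μ₁ μ₂ : Measure ClosedDisc) {h : ℂ × ℂ → ℂ} (hh : IsHolo h)
    (h0 : h (0, 0) = 0) (c : ℂ) :
    normSq μ₁ μ₂ (c • oneFn + h) = ‖c‖ₑ ^ 2 + normSq μ₁ μ₂ h := by
  have h1 : sliceIntegral μ₁ (c • oneFn + h) = sliceIntegral μ₁ h := by
    rw [← sliceIntegral_const_add μ₁ h c]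
    exact sliceIntegral_congr μ₁ fun z hz => by simp [oneFn_apply hz]
  have h2 : sliceIntegral μ₂ (fun z => (c • oneFn + h) (z.2, z.1))
      = sliceIntegral μ₂ fun z => h (z.2, z.1) := by
    rw [← sliceIntegral_const_add μ₂ (fun z => h (z.2, z.1)) c]
    refine sliceIntegral_congr μ₂ fun z hz => ?_
    have : (z.2, z.1) ∈ bidisc := ⟨hz.2, hz.1⟩
    simp [oneFn_apply this]
  simp only [normSq, dirichletIntegral, h1, h2, hardyNormSq_const_add hh h0, add_assoc]

theorem normSq_zero (μ₁ μ₂ : Measure ClosedDisc) : normSq μ₁ μ₂ 0 = 0 := by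
  simpa using normSq_smul μ₁ μ₂ 0 0

theorem normSq_const (μ₁ μ₂ : Measure ClosedDisc) (c : ℂ) :
    normSq μ₁ μ₂ (c • oneFn) = ‖c‖ₑ ^ 2 := by
  simpa [normSq_zero] using normSq_const_add μ₁ μ₂ IsHolo.zero rfl c

/-- Almost every slice in `z₁` over one circle vanishes; then, for each fixed `z₁`, so does the
circle mean in `z₂`. -/
theorem IsHolo.eq_zero_of_hardyNormSq_eq_zero {h : ℂ × ℂ → ℂ} (hh : IsHolo h)
    (h0 : hardyNormSq h = 0) : h = 0 := by
  obtain ⟨r, hr⟩ := Ioo_zero_one_nonempty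
  have h1 := le_antisymm ((le_hardyNormSq h hr).trans h0.le) zero_le
  rw [lintegral_torus_swap hh.measurable, lintegral_eq_zero_iff] at h1
  · have h2 : ∀ a ∈ disc, ∀ b ∈ disc, h (a, b) = 0 := by
      intro a ha
      refine eq_zero_of_circleMean_eq_zero (hh.differentiableOn_slice' ha) hr ?_
      unfold circleMean
      rw [lintegral_congr_ae (g := fun _ => 0), lintegral_zero]
      filter_upwards [h1] with β hβ
      rw [eq_zero_of_circleMean_eq_zero (hh.differentiableOn_slice (polar_mem hr β)) hr hβ a ha]
      simp
    ext z
    by_cases hz : z ∈ bidisc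
    · exact h2 z.1 hz.1 z.2 hz.2
    · exact hh.zero_off z hz
  · have : Measurable fun p : ℝ × ℝ => ‖h (polar r p.2, polar r p.1)‖ₑ ^ 2 :=
      (hh.measurable.comp (((continuous_polar r).measurable.comp measurable_snd).prodMk
        ((continuous_polar r).measurable.comp measurable_fst))).enorm.pow_const 2
    exact this.lintegral_prod_right'

/-! ### One-variable polynomials and their images under an intertwining unitary. -/

/-- A function of one coordinate on the bidisc given by a polynomial. -/
noncomputable def polyFn (π : ℂ × ℂ → ℂ) (p : Polynomial ℂ) : ℂ × ℂ → ℂ :=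
  bidisc.indicator fun z => p.eval (π z)

theorem polyFn_apply (π : ℂ × ℂ → ℂ) (p : Polynomial ℂ) {z : ℂ × ℂ} (hz : z ∈ bidisc) :
    polyFn π p z = p.eval (π z) := indicator_of_mem hz _

theorem sliceIntegral_polyFn_fst (μ : Measure ClosedDisc) (p : Polynomial ℂ) :
    sliceIntegral μ (polyFn Prod.fst p) = weightedDirichlet μ fun w => p.eval w := by
  rw [sliceIntegral_congr μ (g := fun z => p.eval z.1) fun z hz => polyFn_apply _ p hz,
    sliceIntegral_eq_weightedDirichlet]
  simp only [lintegral_const, measure_univ, mul_one]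
  exact biSup_const Ioo_zero_one_nonempty

theorem sliceIntegral_polyFn_snd (μ : Measure ClosedDisc) (p : Polynomial ℂ) :
    sliceIntegral μ (polyFn Prod.snd p) = 0 := by
  rw [sliceIntegral_congr μ (g := fun z => p.eval z.2) fun z hz => polyFn_apply _ p hz]
  simp [sliceIntegral]

theorem polyFn_fst_swap (p : Polynomial ℂ) :
    (fun z : ℂ × ℂ => polyFn Prod.fst p (z.2, z.1)) = polyFn Prod.snd p := by
  ext z
  have : (z.2, z.1) ∈ bidisc ↔ z ∈ bidisc := ⟨fun h => ⟨h.2, h.1⟩, fun h => ⟨h.2, h.1⟩⟩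
  by_cases hz : z ∈ bidisc <;> simp [polyFn, hz, this]

theorem polyFn_snd_swap (p : Polynomial ℂ) :
    (fun z : ℂ × ℂ => polyFn Prod.snd p (z.2, z.1)) = polyFn Prod.fst p := by
  rw [← polyFn_fst_swap]

theorem normSq_polyFn_fst (μ₁ μ₂ : Measure ClosedDisc) (p : Polynomial ℂ) :
    normSq μ₁ μ₂ (polyFn Prod.fst p)
      = hardyNormSq (polyFn Prod.fst p) + weightedDirichlet μ₁ fun w => p.eval w := by
  rw [normSq, dirichletIntegral, sliceIntegral_polyFn_fst, polyFn_fst_swap,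
    sliceIntegral_polyFn_snd, add_zero]

theorem normSq_polyFn_snd (μ₁ μ₂ : Measure ClosedDisc) (p : Polynomial ℂ) :
    normSq μ₁ μ₂ (polyFn Prod.snd p)
      = hardyNormSq (polyFn Prod.snd p) + weightedDirichlet μ₂ fun w => p.eval w := by
  rw [normSq, dirichletIntegral, sliceIntegral_polyFn_snd, polyFn_snd_swap,
    sliceIntegral_polyFn_fst, zero_add]

section Space

variable {μ₁ μ₂ ν₁ ν₂ : Measure ClosedDisc} [IsFiniteMeasure μ₁] [IsFiniteMeasure μ₂]
  [IsFiniteMeasure ν₁] [IsFiniteMeasure ν₂]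

/-- A unitary map intertwining the coordinate multiplications maps constants to constants. -/
theorem exists_map_one_eq (U : DirichletSpace μ₁ μ₂ ≃ₗ[ℂ] DirichletSpace ν₁ ν₂)
    (hU : ∀ f : DirichletSpace μ₁ μ₂, normSq ν₁ ν₂ (U f) = normSq μ₁ μ₂ f)
    (h1 : ∀ f : DirichletSpace μ₁ μ₂, ∃ h : (fun z => z.1 * f.1 z) ∈ DirichletSpace μ₁ μ₂,
      (U ⟨fun z => z.1 * f.1 z, h⟩).1 = fun z => z.1 * (U f).1 z)
    (h2 : ∀ f : DirichletSpace μ₁ μ₂, ∃ h : (fun z => z.2 * f.1 z) ∈ DirichletSpace μ₁ μ₂,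
      (U ⟨fun z => z.2 * f.1 z, h⟩).1 = fun z => z.2 * (U f).1 z) :
    ∃ c : ℂ, ‖c‖ₑ ^ 2 = 1 ∧ (U ⟨oneFn, oneFn_mem⟩).1 = c • oneFn := by
  set e : DirichletSpace μ₁ μ₂ := ⟨oneFn, oneFn_mem⟩ with he
  set g := U e with hg
  set c := g.1 (0, 0) with hc
  set d : DirichletSpace ν₁ ν₂ := g - c • ⟨oneFn, oneFn_mem⟩ with hd
  have hd0 : d.1 (0, 0) = 0 := by simp [hd, hc, oneFn_apply zero_mem_bidisc]
  -- Pulling the two quotients back through `U` yields `x` with `U x = d` and `x(0, 0) = 0`.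
  obtain ⟨k₁, hk₁, k₂, hk₂, hk⟩ := exists_eq_fst_mul_add_snd_mul d.2 hd0
  obtain ⟨m1, e1⟩ := h1 (U.symm ⟨k₁, hk₁⟩)
  obtain ⟨m2, e2⟩ := h2 (U.symm ⟨k₂, hk₂⟩)
  rw [LinearEquiv.apply_symm_apply] at e1 e2
  set x : DirichletSpace μ₁ μ₂ := ⟨_, m1⟩ + ⟨_, m2⟩ with hx
  have hUx : U x = d := by
    apply Subtype.ext
    rw [hk, hx, map_add, Submodule.coe_add, e1, e2]
  have hx0 : x.1 (0, 0) = 0 := by simp [hx]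
  have n1 : normSq ν₁ ν₂ g = 1 := by
    rw [hg, hU]
    simpa using normSq_const μ₁ μ₂ 1
  have n2 : normSq ν₁ ν₂ g = ‖c‖ₑ ^ 2 + normSq ν₁ ν₂ d := by
    rw [← normSq_const_add ν₁ ν₂ d.2.1 hd0]
    congr 1
    simp [hd]
  -- The vector `-g + d` is both the image of `-1 + x` and the constant `-c`, so `|c|² = 1 + ‖d‖²`.
  -- Together with `1 = |c|² + ‖d‖²` this forces `d = 0`.
  have n3 : normSq ν₁ ν₂ ((-1 : ℂ) • g + d : DirichletSpace ν₁ ν₂) = 1 + normSq ν₁ ν₂ d := by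
    rw [← hUx, hg, ← map_smul, ← map_add, hU, hU]
    have := normSq_const_add μ₁ μ₂ x.2.1 hx0 (-1)
    rw [enorm_neg, enorm_one, one_pow] at this
    exact this
  have n4 : normSq ν₁ ν₂ ((-1 : ℂ) • g + d : DirichletSpace ν₁ ν₂) = ‖c‖ₑ ^ 2 := by
    rw [← enorm_neg, ← normSq_const ν₁ ν₂ (-c)]
    congr 1
    simp only [hd, Submodule.coe_add, Submodule.coe_smul, Submodule.coe_sub]
    module
  rw [n3] at n4
  rw [n1, ← n4, add_assoc] at n2
  have hN : normSq ν₁ ν₂ d = 0 := by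
    have h3 : (1 : ℝ≥0∞) + 0 = 1 + (normSq ν₁ ν₂ d + normSq ν₁ ν₂ d) := by rw [← n2, add_zero]
    rw [ENNReal.add_right_inj ENNReal.one_ne_top] at h3
    exact (add_eq_zero.1 h3.symm).1
  refine ⟨c, by rw [← n4, hN, add_zero], ?_⟩
  have hd1 : d.1 = 0 := d.2.1.eq_zero_of_hardyNormSq_eq_zero (add_eq_zero.1 hN).1
  have hd2 : g.1 - c • oneFn = 0 := hd1
  exact sub_eq_zero.1 hd2

/-- Intertwining propagates the value at `1` to all polynomials in the coordinate; `π` stands for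
either projection. -/
theorem map_polyFn_eq (U : DirichletSpace μ₁ μ₂ ≃ₗ[ℂ] DirichletSpace ν₁ ν₂) {π : ℂ × ℂ → ℂ}
    (hπ : ∀ f : DirichletSpace μ₁ μ₂, ∃ h : (fun z => π z * f.1 z) ∈ DirichletSpace μ₁ μ₂,
      (U ⟨fun z => π z * f.1 z, h⟩).1 = fun z => π z * (U f).1 z) {c : ℂ}
    (hc : (U ⟨oneFn, oneFn_mem⟩).1 = c • oneFn) (p : Polynomial ℂ) :
    ∃ h : polyFn π p ∈ DirichletSpace μ₁ μ₂, (U ⟨polyFn π p, h⟩).1 = c • polyFn π p := by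
  induction p using Polynomial.induction_on with
  | C a =>
    have h1 : polyFn π (Polynomial.C a) = a • oneFn := by
      ext z
      by_cases hz : z ∈ bidisc <;> simp [polyFn, oneFn, hz]
    rw [h1]
    refine ⟨Submodule.smul_mem _ a oneFn_mem, ?_⟩
    have h2 : U ⟨a • oneFn, Submodule.smul_mem _ a oneFn_mem⟩ = a • U ⟨oneFn, oneFn_mem⟩ := by
      rw [← map_smul]; rfl
    rw [h2, Submodule.coe_smul, hc, smul_comm]
  | add p q hp hq =>
    obtain ⟨mp, ep⟩ := hp
    obtain ⟨mq, eq⟩ := hq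
    have h1 : polyFn π (p + q) = polyFn π p + polyFn π q := by
      ext z
      by_cases hz : z ∈ bidisc <;> simp [polyFn, hz]
    rw [h1]
    refine ⟨add_mem mp mq, ?_⟩
    have h2 : U ⟨polyFn π p + polyFn π q, add_mem mp mq⟩ = U ⟨_, mp⟩ + U ⟨_, mq⟩ := by
      rw [← map_add]; rfl
    rw [h2, Submodule.coe_add, ep, eq, smul_add]
  | monomial n a h =>
    obtain ⟨m, em⟩ := h
    obtain ⟨m', em'⟩ := hπ ⟨_, m⟩
    have h1 : polyFn π (Polynomial.C a * Polynomial.X ^ (n + 1))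
        = fun z => π z * polyFn π (Polynomial.C a * Polynomial.X ^ n) z := by
      ext z
      by_cases hz : z ∈ bidisc
      · simp only [polyFn, indicator_of_mem hz, Polynomial.eval_mul, Polynomial.eval_C,
          Polynomial.eval_pow, Polynomial.eval_X]
        ring
      · simp [polyFn, hz]
    rw [h1]
    refine ⟨m', ?_⟩
    rw [em', em]
    ext z
    simp only [Pi.smul_apply, smul_eq_mul]
    ring

end Space

/-! ### Recovery of the measures and conclusion. -/

/-- The inclusion of the closed disc, as a bounded continuous function. -/
noncomputable def coordFn : BoundedContinuousFunction ClosedDisc ℂ :=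
  BoundedContinuousFunction.mkOfCompact ⟨fun ζ => (ζ : ℂ), continuous_subtype_val⟩

theorem coordFn_apply (ζ : ClosedDisc) : coordFn ζ = (ζ : ℂ) := rfl

theorem integral_norm_sq_eq {μ : Measure ClosedDisc} {p : ClosedDisc → ℂ} (hp : Continuous p) :
    ∫ ζ, ((‖p ζ‖ ^ 2 : ℝ) : ℂ) ∂μ = ((∫⁻ ζ, ‖p ζ‖ₑ ^ 2 ∂μ).toReal : ℂ) := by
  have hm : AEStronglyMeasurable (fun ζ => ‖p ζ‖ ^ 2) μ :=
    (hp.norm.pow 2).measurable.aestronglyMeasurable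
  rw [integral_complex_ofReal, integral_eq_lintegral_of_nonneg_ae
    (Eventually.of_forall fun _ => by positivity) hm]
  simp only [enorm_sq_eq_ofReal]

theorem four_mul_mul_conj (a b : ℂ) :
    a * conj b = 1 / 4 * (((‖a + b‖ ^ 2 : ℝ) : ℂ) - ((‖a - b‖ ^ 2 : ℝ) : ℂ))
      + Complex.I / 4 * (((‖a + Complex.I * b‖ ^ 2 : ℝ) : ℂ)
        - ((‖a - Complex.I * b‖ ^ 2 : ℝ) : ℂ)) := by
  simp only [← Complex.normSq_eq_norm_sq, ← Complex.mul_conj, map_add, map_sub, map_mul,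
    Complex.conj_I]
  ring_nf
  simp only [Complex.I_sq]
  ring

/-- Finite measures on the closed disc are determined by the norms of the polynomials. -/
theorem measure_eq_of_polynomial_norms {μ ν : Measure ClosedDisc} [IsFiniteMeasure μ]
    [IsFiniteMeasure ν] (h : ∀ p : Polynomial ℂ, ∫⁻ ζ : ClosedDisc, ‖p.eval (ζ : ℂ)‖ₑ ^ 2 ∂μ
      = ∫⁻ ζ : ClosedDisc, ‖p.eval (ζ : ℂ)‖ₑ ^ 2 ∂ν) : μ = ν := by
  have hcont : ∀ p : Polynomial ℂ, Continuous fun ζ : ClosedDisc => p.eval (ζ : ℂ) :=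
    fun p => p.continuous.comp continuous_subtype_val
  have hsq : ∀ p : Polynomial ℂ, ∫ ζ : ClosedDisc, ((‖p.eval (ζ : ℂ)‖ ^ 2 : ℝ) : ℂ) ∂μ
      = ∫ ζ : ClosedDisc, ((‖p.eval (ζ : ℂ)‖ ^ 2 : ℝ) : ℂ) ∂ν := fun p => by
    rw [integral_norm_sq_eq (hcont p), integral_norm_sq_eq (hcont p), h p]
  have hint : ∀ (m : Measure ClosedDisc) [IsFiniteMeasure m] (p : Polynomial ℂ),
      Integrable (fun ζ : ClosedDisc => ((‖p.eval (ζ : ℂ)‖ ^ 2 : ℝ) : ℂ)) m := fun m _ p =>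
    (Complex.continuous_ofReal.comp ((hcont p).norm.pow 2)).integrable_of_hasCompactSupport
      (HasCompactSupport.of_compactSpace _)
  -- Polarization: the norms of polynomials determine all the moments `∫ p conj q`.
  have hexp : ∀ (m : Measure ClosedDisc) [IsFiniteMeasure m] (p q : Polynomial ℂ),
      ∫ ζ : ClosedDisc, p.eval (ζ : ℂ) * conj (q.eval (ζ : ℂ)) ∂m
        = 1 / 4 * (∫ ζ : ClosedDisc, ((‖(p + q).eval (ζ : ℂ)‖ ^ 2 : ℝ) : ℂ) ∂m
            - ∫ ζ : ClosedDisc, ((‖(p - q).eval (ζ : ℂ)‖ ^ 2 : ℝ) : ℂ) ∂m)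
          + Complex.I / 4 * (∫ ζ : ClosedDisc,
              ((‖(p + Polynomial.C Complex.I * q).eval (ζ : ℂ)‖ ^ 2 : ℝ) : ℂ) ∂m
            - ∫ ζ : ClosedDisc,
              ((‖(p - Polynomial.C Complex.I * q).eval (ζ : ℂ)‖ ^ 2 : ℝ) : ℂ) ∂m) := by
    intro m _ p q
    have hdiff : ∀ (a : ℂ) (p q : Polynomial ℂ), Integrable (fun ζ : ClosedDisc => a *
        (((‖p.eval (ζ : ℂ)‖ ^ 2 : ℝ) : ℂ) - ((‖q.eval (ζ : ℂ)‖ ^ 2 : ℝ) : ℂ))) m :=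
      fun a p q => ((hint m p).sub (hint m q)).const_mul a
    rw [← integral_sub (hint m _) (hint m _), ← integral_sub (hint m _) (hint m _),
      ← integral_const_mul, ← integral_const_mul, ← integral_add
        (hdiff _ _ _) (hdiff _ _ _)]
    refine integral_congr_ae (Eventually.of_forall fun ζ => ?_)
    simp only
    rw [four_mul_mul_conj]
    simp
  have hmom : ∀ p q : Polynomial ℂ,
      ∫ ζ : ClosedDisc, p.eval (ζ : ℂ) * conj (q.eval (ζ : ℂ)) ∂μ
        = ∫ ζ : ClosedDisc, p.eval (ζ : ℂ) * conj (q.eval (ζ : ℂ)) ∂ν := fun p q => by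
    simp only [hexp, hsq]
  -- The star algebra generated by the coordinate separates points, so its integrals determine the
  -- measure.
  refine ext_of_forall_mem_subalgebra_integral_eq_of_pseudoEMetric_complete_countable (𝕜 := ℂ)
    (A := StarAlgebra.adjoin ℂ {coordFn}) ?_ ?_
  · intro x y hxy
    refine ⟨_, ⟨BoundedContinuousFunction.toContinuousMapStarₐ ℂ coordFn,
      StarSubalgebra.mem_map.2 ⟨coordFn, StarAlgebra.subset_adjoin ℂ _ rfl, rfl⟩, rfl⟩, ?_⟩
    exact fun h => hxy (Subtype.ext h)
  · intro g hg
    -- That algebra is spanned by products of the coordinate and its conjugate, that is, by the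
    -- monomials `ζ^m conj(ζ^n)`.
    have hg' : g ∈ Submodule.span ℂ
        (Submonoid.closure ({coordFn} ∪ star {coordFn}) :
          Set (BoundedContinuousFunction ClosedDisc ℂ)) := by
      rw [← Algebra.adjoin_eq_span]
      exact hg
    induction hg' using Submodule.span_induction with
    | mem x hx =>
      have hx' : ∃ m n : ℕ, ∀ ζ : ClosedDisc, x ζ = (ζ : ℂ) ^ m * conj ((ζ : ℂ) ^ n) := by
        clear hg
        induction hx using Submonoid.closure_induction with
        | mem x hx =>
          rcases hx with hx | hx
          · rw [mem_singleton_iff] at hx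
            subst hx
            exact ⟨1, 0, fun ζ => by simp [coordFn_apply]⟩
          · rw [star_singleton, mem_singleton_iff] at hx
            subst hx
            exact ⟨0, 1, fun ζ => by simp [coordFn_apply]⟩
        | one => exact ⟨0, 0, fun ζ => by simp⟩
        | mul x y _ _ ihx ihy =>
          obtain ⟨m, n, h1⟩ := ihx
          obtain ⟨m', n', h2⟩ := ihy
          refine ⟨m + m', n + n', fun ζ => ?_⟩
          rw [BoundedContinuousFunction.mul_apply, h1, h2, pow_add, pow_add, map_mul]
          ring
      obtain ⟨m, n, h1⟩ := hx'
      simp only [h1]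
      simpa using hmom (Polynomial.X ^ m) (Polynomial.X ^ n)
    | zero => simp
    | add x y hx hy ihx ihy =>
      have e : ∀ m : Measure ClosedDisc, ∀ [IsFiniteMeasure m],
          ∫ ζ, (x + y) ζ ∂m = ∫ ζ, x ζ ∂m + ∫ ζ, y ζ ∂m := fun m _ => by
        rw [← integral_add (x.integrable m) (y.integrable m)]
        rfl
      have hmem : ∀ x ∈ Submodule.span ℂ
          (Submonoid.closure ({coordFn} ∪ star {coordFn}) :
            Set (BoundedContinuousFunction ClosedDisc ℂ)), x ∈ StarAlgebra.adjoin ℂ {coordFn} := by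
        intro x hx
        rw [← Algebra.adjoin_eq_span] at hx
        exact hx
      rw [e, e, ihx (hmem x hx), ihy (hmem y hy)]
    | smul a x hx ih =>
      have e : ∀ m : Measure ClosedDisc,
          ∫ ζ, (a • x) ζ ∂m = a • ∫ ζ, x ζ ∂m := fun m => by
        rw [← integral_smul]
        rfl
      have hmem : x ∈ StarAlgebra.adjoin ℂ {coordFn} := by
        rw [← Algebra.adjoin_eq_span] at hx
        exact hx
      rw [e, e, ih hmem]

/-- Comparing the hypothesis for `p` and for `X * p` isolates `∫ |p|²`, since the Dirichlet integral
of `p` is finite and can be cancelled. -/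
theorem measure_eq_of_weightedDirichlet_eq {μ ν : Measure ClosedDisc} [IsFiniteMeasure μ]
    [IsFiniteMeasure ν] (h : ∀ p : Polynomial ℂ, weightedDirichlet μ (fun w => p.eval w)
      = weightedDirichlet ν fun w => p.eval w) : μ = ν := by
  refine measure_eq_of_polynomial_norms fun p => ?_
  have h1 := h (Polynomial.X * p)
  simp only [Polynomial.eval_mul, Polynomial.eval_X] at h1
  rw [weightedDirichlet_id_mul_polynomial, weightedDirichlet_id_mul_polynomial, h p] at h1
  exact (ENNReal.add_right_inj (weightedDirichlet_polynomial_lt_top ν p).ne).1 h1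

theorem UnitarilyEquivalent.eq {μ₁ μ₂ ν₁ ν₂ : Measure ClosedDisc}
    [IsFiniteMeasure μ₁] [IsFiniteMeasure μ₂] [IsFiniteMeasure ν₁] [IsFiniteMeasure ν₂]
    (h : UnitarilyEquivalent μ₁ μ₂ ν₁ ν₂) : μ₁ = ν₁ ∧ μ₂ = ν₂ := by
  obtain ⟨U, hU, h1, h2⟩ := h
  obtain ⟨c, hc, hUc⟩ := exists_map_one_eq U hU h1 h2
  constructor
  · refine measure_eq_of_weightedDirichlet_eq fun p => ?_
    obtain ⟨m, e⟩ := map_polyFn_eq U h1 hUc p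
    have h3 := hU ⟨_, m⟩
    rw [e, normSq_smul, hc, one_mul, normSq_polyFn_fst, normSq_polyFn_fst,
      ENNReal.add_right_inj m.2.1.ne] at h3
    exact h3.symm
  · refine measure_eq_of_weightedDirichlet_eq fun p => ?_
    obtain ⟨m, e⟩ := map_polyFn_eq U h2 hUc p
    have h3 := hU ⟨_, m⟩
    rw [e, normSq_smul, hc, one_mul, normSq_polyFn_snd, normSq_polyFn_snd,
      ENNReal.add_right_inj m.2.1.ne] at h3
    exact h3.symm

theorem unitarilyEquivalent_refl (μ₁ μ₂ : Measure ClosedDisc) [IsFiniteMeasure μ₁]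
    [IsFiniteMeasure μ₂] : UnitarilyEquivalent μ₁ μ₂ μ₁ μ₂ :=
  ⟨LinearEquiv.refl ℂ _, fun _ => rfl, fun f => ⟨fst_mul_mem f.2, rfl⟩,
    fun f => ⟨snd_mul_mem f.2, rfl⟩⟩

end DirichletBidisc

theorem mainTheorem4 (μ₁ μ₂ ν₁ ν₂ : MeasureTheory.Measure DirichletBidisc.ClosedDisc)
    [MeasureTheory.IsFiniteMeasure μ₁] [MeasureTheory.IsFiniteMeasure μ₂]
    [MeasureTheory.IsFiniteMeasure ν₁] [MeasureTheory.IsFiniteMeasure ν₂] :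
    DirichletBidisc.UnitarilyEquivalent μ₁ μ₂ ν₁ ν₂ ↔ μ₁ = ν₁ ∧ μ₂ = ν₂ := by
  refine ⟨fun h => h.eq, ?_⟩
  rintro ⟨rfl, rfl⟩
  exact DirichletBidisc.unitarilyEquivalent_refl μ₁ μ₂
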